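/- **Conventions.** All fans are real and simplicial: a fan $\Sigma$ in a finite-dimensional real vector space $V$ is a set of strongly convex polyhedral cones, each generated by linearly independent vectors, that contains the faces of its members and in which any two cones intersect in a common face. It is complete if its cones cover $V$. It is a fan over the abstract simplicial complex $K$ if, for suitable generators $x_v$ of its $1$-cones indexed by the vertices $v$ of $K$, the assignment $\sigma\mapsto\operatorname{pos}\{x_v: v\in\sigma\}$ is a bijection from the faces of $K$ (including $\varnothing$) to the cones of $\Sigma$, where $\operatorname{pos}$ denotes the set of nonnegative linear combinations. For a face $\sigma$ of $K$ with cone $\tau=\operatorname{pos}\{x_v: v\in\sigma\}$, the projected fan $\operatorname{proj}_\sigma\Sigma$ is the set of images in $V/\operatorname{span}\tau$ of the cones $C\in\Sigma$ with $\tau\subseteq C$. A fan $\Sigma$ in $V$ is strongly polytopal if there is a simplicial polytope $P\subset V$ with $0\in\operatorname{int}P$ and $\Sigma=\{\operatorname{pos}F: F \text{ a proper face of } P\}$, the empty face included. **Proposition.** Let $k\ge 0$ and $n_1,\dots,n_k\ge 1$ be integers, and let $\Sigma$ be a complete fan over $K=\partial\Delta^{n_1}\star\cdots\star\partial\Delta^{n_k}$,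 where the $i$-th factor has vertex set $\{i_0,\dots,i_{n_i}\}$. Suppose that, for every choice of nonempty subsets $A_i\subseteq\{i_0,\dots,i_{n_i}\}$ with $|A_i|\le k-1$ $(i=1,\dots,k)$, the projected fan $\operatorname{proj}_\sigma\Sigma$ with respect to the face $\sigma=V(K)\setminus(A_1\cup\dots\cup A_k)$ is strongly polytopal. Then $\Sigma$ is strongly polytopal. -/

import Mathlib

noncomputable section

/-- The boundary complex of the `m`-simplex with vertices `0, …, m`: all proper subsets of the
vertex set (the empty face included). -/
def simplexBoundary (m : ℕ) : Set (Finset (Fin (m + 1))) :=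
  {s | s ≠ Finset.univ}

/-- The join of a finite family of abstract simplicial complexes (the empty face is a face of each
of them), on the disjoint union of the vertex sets: the faces are the disjoint unions
`⋃ i, s i` with `s i` a face of `K i`. -/
def joinComplex {ι : Type*} [Fintype ι] {W : ι → Type*} (K : ∀ i, Set (Finset (W i))) :
    Set (Finset (Σ i, W i)) :=
  {t | ∃ s : ∀ i, Finset (W i), (∀ i, s i ∈ K i) ∧ t = Finset.univ.sigma s}

section Fans

variable {V : Type*} [AddCommGroup V] [Module ℝ V]

/-- `D` is a face of the cone `C`: `D = C ∩ {f = 0}` for a linear functional `f` that is nonnegative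
on `C`. The choice `f = 0` gives `C` itself. -/
def IsConeFace (D C : PointedCone ℝ V) : Prop :=
  ∃ f : V →ₗ[ℝ] ℝ, (∀ v ∈ C, 0 ≤ f v) ∧ ∀ v, v ∈ D ↔ v ∈ C ∧ f v = 0

/-- A fan: a set of strongly convex polyhedral cones, closed under taking faces, in which any two
cones intersect in a common face. -/
structure IsFan (𝓕 : Set (PointedCone ℝ V)) : Prop where
  polyhedral : ∀ C ∈ 𝓕, ∃ X : Set V, X.Finite ∧ C = PointedCone.hull ℝ X
  stronglyConvex : ∀ C ∈ 𝓕, ∀ v, v ∈ C → -v ∈ C → v = 0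
  face_mem : ∀ C ∈ 𝓕, ∀ D, IsConeFace D C → D ∈ 𝓕
  inter_face : ∀ C ∈ 𝓕, ∀ D ∈ 𝓕, IsConeFace (C ⊓ D) C ∧ IsConeFace (C ⊓ D) D

/-- A fan is complete if its cones cover the whole space. -/
def IsCompleteFan (𝓕 : Set (PointedCone ℝ V)) : Prop :=
  IsFan 𝓕 ∧ ∀ v : V, ∃ C ∈ 𝓕, v ∈ C

/-- `𝓕` is a simplicial fan over the simplicial complex `K`, where `x v` is a generator of the
`1`-cone of the vertex `v`: the cones of `𝓕` are the cones spanned by the `x v`, `v ∈ s`, for the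
faces `s` of `K`; these generators are linearly independent, and distinct faces give distinct
cones. -/
structure IsFanOver {ι : Type*} (𝓕 : Set (PointedCone ℝ V)) (K : Set (Finset ι)) (x : ι → V) :
    Prop where
  isFan : IsFan 𝓕
  linearIndepOn : ∀ s ∈ K, LinearIndepOn ℝ x (s : Set ι)
  cones_eq : 𝓕 = (fun s : Finset ι => PointedCone.hull ℝ (x '' (s : Set ι))) '' K
  injOn : Set.InjOn (fun s : Finset ι => PointedCone.hull ℝ (x '' (s : Set ι))) K

/-- The projected fan of `𝓕` with respect to its cone `τ`: the images of the cones of `𝓕` that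
contain `τ`, in the quotient of the ambient space by the linear span of `τ`. -/
def projectedFan (𝓕 : Set (PointedCone ℝ V)) (τ : PointedCone ℝ V) :
    Set (PointedCone ℝ (V ⧸ Submodule.span ℝ (τ : Set V))) :=
  PointedCone.map (Submodule.mkQ (Submodule.span ℝ (τ : Set V))) '' {C | C ∈ 𝓕 ∧ τ ≤ C}

end Fans

section Polytopes

variable {V : Type*} [AddCommGroup V] [Module ℝ V] [TopologicalSpace V]

/-- `F` is a proper face of the polytope `P` (the empty face is allowed). -/
def IsProperFace (F P : Set V) : Prop :=
  IsExposed ℝ P F ∧ F ≠ P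

/-- A simplicial polytope: the convex hull of a finite set, all of whose proper faces are
simplices. -/
def IsSimplicialPolytope (P : Set V) : Prop :=
  (∃ X : Set V, X.Finite ∧ P = convexHull ℝ X) ∧
    ∀ F, IsProperFace F P →
      ∃ T : Finset V, AffineIndependent ℝ ((↑) : T → V) ∧ F = convexHull ℝ (T : Set V)

/-- A fan is strongly polytopal if it consists of the cones spanned by the proper faces of a
simplicial polytope with the origin in its interior. -/
def IsStronglyPolytopal (𝓕 : Set (PointedCone ℝ V)) : Prop :=
  ∃ P : Set V, IsSimplicialPolytope P ∧ (0 : V) ∈ interior P ∧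
    𝓕 = PointedCone.hull ℝ '' {F | IsProperFace F P}

end Polytopes

end

/-! Gale duality turns polytopality into a question about intersecting cones, which a Helly type
theorem answers. The facets of K are the complements of the transversals `τ`, which pick one vertex
from each factor. Let G be the space, of dimension k, of real functions on the vertices modulo
restrictions of linear functionals. For each `τ` the Gale vectors of the omitted vertices form a
basis of G; the i-th coordinate of the class of `a` is a(v) - ψ(x_v), where v = (i, τ i) and the
linear functional ψ agrees with `a` on the facet (`IsFanOver.galeBasis_coord`). So `a` is a strictly
convex support function iff its class is interior to the simplicial cone of every `τ`. Such an `a`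
yields the polytope (`IsFanOver.isStronglyPolytopal_of_strictly_convex`). Projection keeps the
transversals inside the A_i, so the hypothesis says that the cones of every small subconfiguration
meet (`IsFanOver.exists_strictly_convex_of_projected`).

To pass from small to all (`conesMeet_of_small`), consider a colour class i₀ with at least k members
such that the cones meet after deletion of any one. Gale vectors of colour i have positive i-th
coordinate in every basis, because adjacent facets lie on opposite sides of their wall. In the
affine coordinates coord l / coord i₀, a common interior point is then a common strict upper bound
of the class for a partial order. `exists_common_upper_bound` finds one: otherwise, slide one point
from the position of another to its own until the bound is first lost; the at most k constraints in
a dependence at that moment are contradictory. -/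

/-! ### Finite systems of strict linear inequalities. -/

section LinearInequalities

variable {U : Type*} [AddCommGroup U] [Module ℝ U] {J : Type*}

/-- Gordan's theorem: a finite system of strict homogeneous linear inequalities without solution
has a nontrivial nonnegative linear dependence. -/
theorem exists_nonneg_dependence_of_infeasible [Fintype J] (φ : J → Module.Dual ℝ U)
    (hφ : ¬ ∃ z, ∀ a, 0 < φ a z) :
    ∃ c : J → ℝ, (∀ a, 0 ≤ c a) ∧ c ≠ 0 ∧ ∑ a, c a • φ a = 0 := by
  classical
  set s : Set (J → ℝ) := {v | ∀ a, 0 < v a} with hs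
  have hsc : Convex ℝ s := by
    intro v hv w hw p q hp hq hpq a
    rcases hp.eq_or_lt with rfl | hp
    · have : q = 1 := by linarith
      simpa [this] using hw a
    · have h1 := mul_pos hp (hv a)
      have h2 := mul_nonneg hq (hw a).le
      simp only [Pi.add_apply, Pi.smul_apply, smul_eq_mul]
      linarith
  have hso : IsOpen s := by
    rw [hs, Set.ofPred_forall]
    exact isOpen_iInter_of_finite fun a => isOpen_lt continuous_const (continuous_apply a)
  have hdisj : Disjoint s ((LinearMap.range (LinearMap.pi φ) : Submodule ℝ (J → ℝ)) : Set _) := by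
    rw [Set.disjoint_left]
    rintro _ hv ⟨z, rfl⟩
    exact hφ ⟨z, hv⟩
  -- Separate the open positive orthant from the subspace of value vectors; the negated coefficients
  -- of `g` form the dependence.
  obtain ⟨g, u, hgs, hgr⟩ :=
    geometric_hahn_banach_open hsc hso (Submodule.convex _) hdisj
  have hu : u ≤ 0 := by simpa using hgr 0 (Submodule.zero_mem _)
  have hg0 : ∀ z, g (fun a => φ a z) = 0 := by
    intro z
    by_contra hne
    have h := hgr (((u - 1) / g (fun a => φ a z)) • fun a => φ a z)
      (Submodule.smul_mem _ _ ⟨z, rfl⟩)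
    rw [map_smul, smul_eq_mul, div_mul_cancel₀ _ hne] at h
    linarith
  have hg : ∀ v : J → ℝ, g v = ∑ a, v a * g (Pi.single a 1) := by
    intro v
    conv_lhs => rw [pi_eq_sum_univ' v]
    simp only [map_sum, map_smul, smul_eq_mul]
  have hone : g 1 < 0 := (hgs 1 fun a => one_pos).trans_le hu
  refine ⟨fun a => - g (Pi.single a 1), fun a => ?_, ?_, ?_⟩
  · by_contra hlt
    push Not at hlt
    have hpos : 0 < g (Pi.single a 1) := by linarith
    have h := hgs (1 + (- g 1 / g (Pi.single a 1)) • Pi.single a 1) (fun b => by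
      have : 0 ≤ (- g 1 / g (Pi.single a 1)) * (Pi.single a 1 : J → ℝ) b := by
        apply mul_nonneg (div_nonneg (by linarith) hpos.le)
        by_cases hb : b = a
        · subst hb; simp
        · simp [hb]
      simp only [Pi.add_apply, Pi.one_apply, Pi.smul_apply, smul_eq_mul]
      linarith)
    rw [map_add, map_smul, smul_eq_mul, div_mul_cancel₀ _ hpos.ne'] at h
    linarith
  · intro h0
    rw [hg] at hone
    have : ∀ a, g (Pi.single a 1) = 0 := fun a => by
      have := congrFun h0 a
      simpa using this
    simp [this] at hone
  · ext z
    have h := hg0 z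
    rw [hg] at h
    simp only [LinearMap.sum_apply, LinearMap.smul_apply, smul_eq_mul, LinearMap.zero_apply]
    rw [← neg_eq_zero, ← Finset.sum_neg_distrib, ← h]
    exact Finset.sum_congr rfl fun a _ => by ring

/-- A sparse dependence of an infeasible finite system whose members are all nonnegative at a
nonzero point `p`: its members vanish at `p`, and there are at most `dim U` of them. -/
theorem exists_small_dependence_of_infeasible [FiniteDimensional ℝ U] [Fintype J]
    (φ : J → Module.Dual ℝ U) (hφ : ¬ ∃ z, ∀ a, 0 < φ a z) {p : U} (hp : p ≠ 0)
    (hφp : ∀ a, 0 ≤ φ a p) :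
    ∃ (I : Finset J) (c : J → ℝ), I.Nonempty ∧ (∀ a ∈ I, 0 < c a ∧ φ a p = 0) ∧
      I.card ≤ Module.finrank ℝ U ∧ ∑ a ∈ I, c a • φ a = 0 := by
  classical
  obtain ⟨c, hc0, hcne, hc⟩ := exists_nonneg_dependence_of_infeasible φ hφ
  have hcs : 0 < ∑ a, c a := by
    obtain ⟨a, ha⟩ := Function.ne_iff.1 hcne
    exact Finset.sum_pos' (fun a _ => hc0 a) ⟨a, Finset.mem_univ _, (hc0 a).lt_of_ne' ha⟩
  have hmem : (0 : Module.Dual ℝ U) ∈ convexHull ℝ (Set.range φ) := by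
    have h := Finset.centerMass_mem_convexHull (R := ℝ) Finset.univ (w := c) (z := φ)
      (s := Set.range φ) (fun a _ => hc0 a) hcs (fun a _ => ⟨a, rfl⟩)
    rwa [Finset.centerMass, hc, smul_zero] at h
  -- Carathéodory: affinely independent members suffice.
  rw [convexHull_eq_union] at hmem
  simp only [Set.mem_iUnion] at hmem
  obtain ⟨t, hts, hti, ht⟩ := hmem
  rw [Finset.mem_convexHull'] at ht
  obtain ⟨w, hw0, hw1, hw⟩ := ht
  have htp : ∀ e ∈ t, 0 ≤ e p := fun e he => by
    obtain ⟨a, rfl⟩ := hts he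
    exact hφp a
  set t' := t.filter (fun e => w e ≠ 0) with ht'
  have hw1' : ∑ e ∈ t', w e = 1 := by
    rw [ht', Finset.sum_filter_ne_zero]; exact hw1
  have hw' : ∑ e ∈ t', w e • e = 0 := by
    rw [← hw, ht', Finset.sum_filter]
    exact Finset.sum_congr rfl fun e _ => by by_cases h : w e = 0 <;> simp [h]
  have hpos : ∀ e ∈ t', 0 < w e := fun e he =>
    (hw0 e (Finset.mem_filter.1 he).1).lt_of_ne' (Finset.mem_filter.1 he).2
  have hzero : ∀ e ∈ t', e p = 0 := by
    have h := congrArg (fun l : Module.Dual ℝ U => l p) hw'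
    simp only [LinearMap.sum_apply, LinearMap.smul_apply, smul_eq_mul,
      LinearMap.zero_apply] at h
    rw [Finset.sum_eq_zero_iff_of_nonneg
      (fun e he => mul_nonneg (hpos e he).le (htp e (Finset.mem_filter.1 he).1))] at h
    intro e he
    exact (mul_eq_zero.1 (h e he)).resolve_left (hpos e he).ne'
  have hne : t'.Nonempty := by
    rw [Finset.nonempty_iff_ne_empty]
    intro h0
    simp [h0] at hw1'
  have hcard : t'.card ≤ Module.finrank ℝ U := by
    have hti' : AffineIndependent ℝ ((↑) : t' → Module.Dual ℝ U) :=
      hti.mono (Finset.coe_subset.2 (Finset.filter_subset _ _))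
    have : Nonempty t' := hne.to_subtype
    have h1 := hti'.finrank_vectorSpan_add_one
    rw [Fintype.card_coe] at h1
    -- The members used annihilate `p`, so they lie in a space of dimension `dim U - 1`, which holds
    -- at most `dim U` affinely independent points.
    have h2 : vectorSpan ℝ (Set.range ((↑) : t' → Module.Dual ℝ U)) ≤
        (ℝ ∙ p).dualAnnihilator := by
      rw [vectorSpan_def, Submodule.span_le]
      rintro _ ⟨_, ⟨e, rfl⟩, _, ⟨e', rfl⟩, rfl⟩
      rw [SetLike.mem_coe, Submodule.mem_dualAnnihilator]
      intro v hv
      obtain ⟨r, rfl⟩ := Submodule.mem_span_singleton.1 hv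
      simp [hzero e e.2, hzero e' e'.2]
    have h3 := Submodule.finrank_mono h2
    have h4 := Subspace.finrank_add_finrank_dualAnnihilator_eq (ℝ ∙ p)
    rw [finrank_span_singleton hp] at h4
    omega
  have : Nonempty J := (Function.ne_iff.1 hcne).nonempty
  choose! g hg using fun e (he : e ∈ t') => hts (Finset.mem_filter.1 he).1
  have hinj : Set.InjOn g t' := fun e he e' he' h => by rw [← hg e he, ← hg e' he', h]
  refine ⟨t'.image g, fun a => w (φ a), hne.image _, ?_, ?_, ?_⟩
  · intro a ha
    obtain ⟨e, he, rfl⟩ := Finset.mem_image.1 ha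
    simp only [hg e he]
    exact ⟨hpos e he, hzero e he⟩
  · exact Finset.card_image_le.trans hcard
  · rw [Finset.sum_image hinj, ← hw']
    exact Finset.sum_congr rfl fun e he => by simp only [hg e he]

/-- An affine path of finite systems of strict inequalities which is feasible at time `0` and
infeasible at time `1` has a first infeasible time, at which the weak system has a nonzero
solution. -/
theorem exists_first_infeasible [FiniteDimensional ℝ U] [Fintype J]
    (φ₀ φ₁ : J → Module.Dual ℝ U)
    (h0 : ∃ z, ∀ a, 0 < (φ₀ a + (0 : ℝ) • φ₁ a) z)
    (h1 : ¬ ∃ z, ∀ a, 0 < (φ₀ a + (1 : ℝ) • φ₁ a) z) :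
    ∃ t : ℝ, 0 ≤ t ∧ t ≤ 1 ∧ (¬ ∃ z, ∀ a, 0 < (φ₀ a + t • φ₁ a) z) ∧
      ∃ p : U, p ≠ 0 ∧ ∀ a, 0 ≤ (φ₀ a + t • φ₁ a) p := by
  classical
  have hJ : Nonempty J := by
    by_contra h
    rw [not_nonempty_iff] at h
    exact h1 ⟨0, fun a => h.elim a⟩
  let e := (Module.finBasis ℝ U).equivFun
  have hcont : ∀ l : Module.Dual ℝ U, Continuous fun v => l (e.symm v) := fun l =>
    (l ∘ₗ e.symm.toLinearMap).continuous_of_finiteDimensional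
  have hco : ∀ a, Continuous fun q : ℝ × (Fin (Module.finrank ℝ U) → ℝ) =>
      (φ₀ a + q.1 • φ₁ a) (e.symm q.2) := fun a => by
    simp only [LinearMap.add_apply, LinearMap.smul_apply, smul_eq_mul]
    exact ((hcont _).comp continuous_snd).add
      (continuous_fst.mul ((hcont _).comp continuous_snd))
  set N : Set ℝ := Set.Icc 0 1 ∩ {t | ¬ ∃ z, ∀ a, 0 < (φ₀ a + t • φ₁ a) z} with hN
  have hNc : IsCompact N := by
    refine isCompact_Icc.inter_right ?_
    rw [← isOpen_compl_iff]
    have : {t : ℝ | ¬ ∃ z, ∀ a, 0 < (φ₀ a + t • φ₁ a) z}ᶜ =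
        ⋃ z, ⋂ a, {t | 0 < (φ₀ a + t • φ₁ a) z} := by
      ext t; simp
    rw [this]
    refine isOpen_iUnion fun z => isOpen_iInter_of_finite fun a => ?_
    refine isOpen_lt continuous_const ?_
    simp only [LinearMap.add_apply, LinearMap.smul_apply, smul_eq_mul]
    fun_prop
  obtain ⟨t, ht, htmin⟩ := hNc.exists_isLeast ⟨1, ⟨zero_le_one, le_rfl⟩, h1⟩
  have ht0 : 0 < t := by
    refine ht.1.1.lt_of_ne ?_
    rintro rfl
    exact ht.2 h0
  refine ⟨t, ht.1.1, ht.1.2, ht.2, ?_⟩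
  -- Solutions normalised to the unit sphere form a compact set, so weak solvability passes from
  -- earlier times to the limit `t`.
  set Z : Set (ℝ × (Fin (Module.finrank ℝ U) → ℝ)) :=
    (Set.Icc 0 1 ×ˢ Metric.sphere 0 1) ∩ {q | ∀ a, 0 ≤ (φ₀ a + q.1 • φ₁ a) (e.symm q.2)} with hZ
  have hZc : IsCompact Z := by
    refine (isCompact_Icc.prod (isCompact_sphere 0 1)).inter_right ?_
    rw [Set.ofPred_forall]
    exact isClosed_iInter fun a => isClosed_le continuous_const (hco a)
  have hproj : IsClosed (Prod.fst '' Z) := (hZc.image continuous_fst).isClosed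
  have hsub : Set.Ico 0 t ⊆ Prod.fst '' Z := by
    intro s hs
    have hs1 : s ∈ Set.Icc (0 : ℝ) 1 := ⟨hs.1, hs.2.le.trans ht.1.2⟩
    have hfeas : ∃ z, ∀ a, 0 < (φ₀ a + s • φ₁ a) z := by
      by_contra h
      exact absurd (htmin ⟨hs1, h⟩) (not_le.2 hs.2)
    obtain ⟨z, hz⟩ := hfeas
    have hz0 : e z ≠ 0 := by
      intro h
      have : z = 0 := by simpa using h
      obtain ⟨a⟩ := hJ
      simpa [this] using hz a
    refine ⟨(s, ‖e z‖⁻¹ • e z), ⟨⟨hs1, ?_⟩, fun a => ?_⟩, rfl⟩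
    · simp [norm_smul, inv_mul_cancel₀ (norm_ne_zero_iff.2 hz0)]
    · simp only [map_smul, LinearEquiv.symm_apply_apply]
      exact mul_nonneg (inv_nonneg.2 (norm_nonneg _)) (hz a).le
  have hmem : t ∈ Prod.fst '' Z := by
    have h := hproj.closure_subset_iff.2 hsub
    rw [closure_Ico ht0.ne] at h
    exact h ⟨ht0.le, le_rfl⟩
  obtain ⟨⟨s, v⟩, ⟨⟨-, hv⟩, hpos⟩, rfl⟩ := hmem
  refine ⟨e.symm v, ?_, hpos⟩
  intro h
  have : v = 0 := by simpa using h
  simp [this] at hv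

end LinearInequalities

/-! ### The Helly type theorem for common upper bounds. -/

section CausalHelly

variable {U : Type*} [AddCommGroup U] [Module ℝ U]

/-- A Helly type theorem. The points `z` with `f t z > 0` for all `t` are partially ordered by the
relation `∀ s, 0 < ω s r z`, where each `ω s` is an area form of rank two. If any `card R - 1` of
the points `r j` have a common strict upper bound and `card R ≥ dim U`, then all of them have. -/
theorem exists_common_upper_bound [FiniteDimensional ℝ U] {R T S : Type*} [Fintype R]
    [Fintype T] [Fintype S] (r : R → U) (f : T → Module.Dual ℝ U)
    (ω : S → U →ₗ[ℝ] U →ₗ[ℝ] ℝ) (h : S → T) (hanti : ∀ s a b, ω s a b = - ω s b a)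
    (hω : ∀ s a b c, f (h s) a * ω s b c + f (h s) b * ω s c a + f (h s) c * ω s a b = 0)
    (hr : ∀ j t, 0 < f t (r j))
    (hpt : ∀ j p, (∀ t, f t p = 0) → (∀ s, ω s (r j) p = 0) → p = 0)
    (hdim : Module.finrank ℝ U ≤ Fintype.card R) (h2 : 2 ≤ Fintype.card R)
    (hsub : ∀ l, ∃ z, (∀ t, 0 < f t z) ∧ ∀ j, j ≠ l → ∀ s, 0 < ω s (r j) z) :
    ∃ z, (∀ t, 0 < f t z) ∧ ∀ j s, 0 < ω s (r j) z := by
  classical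
  by_contra hno
  choose z hzf hzω using hsub
  obtain ⟨i₀, i₁, hne⟩ := Fintype.exists_pair_of_one_lt_card (α := R) h2
  -- By `hpt`, `ℓ` is positive at any nonzero weak solution `p`. The extra constraints `f t - ε • ℓ`
  -- then force `f t p > 0`; `ε` is small enough to keep every `z l` admissible.
  set ℓ : Module.Dual ℝ U := ∑ t, f t + ∑ s, ω s (r i₁) with hℓ
  obtain ⟨ε, hε, hεz⟩ : ∃ ε : ℝ, 0 < ε ∧ ∀ l t, 0 < (f t - ε • ℓ) (z l) := by
    have : ∀ᶠ ε : ℝ in nhdsWithin 0 (Set.Ioi 0), ∀ l t, 0 < (f t - ε • ℓ) (z l) := by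
      rw [Filter.eventually_all]; intro l
      rw [Filter.eventually_all]; intro t
      have hc : Continuous fun ε : ℝ => (f t - ε • ℓ) (z l) := by
        simp only [LinearMap.sub_apply, LinearMap.smul_apply, smul_eq_mul]
        fun_prop
      refine Filter.Eventually.filter_mono nhdsWithin_le_nhds ?_
      refine hc.continuousAt.eventually (lt_mem_nhds ?_)
      simpa using hzf l t
    obtain ⟨ε, h1, h2⟩ := (this.and self_mem_nhdsWithin).exists
    exact ⟨ε, h2, h1⟩
  -- The point with index `i₀` moves along the segment from `r i₁` to `r i₀`. At time `0` the system
  -- is solved by `z i₀`.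
  let φ₀ : (T ⊕ T) ⊕ (R × S) → Module.Dual ℝ U :=
    Sum.elim (Sum.elim f fun t => f t - ε • ℓ)
      fun q => ω q.2 (if q.1 = i₀ then r i₁ else r q.1)
  let φ₁ : (T ⊕ T) ⊕ (R × S) → Module.Dual ℝ U :=
    Sum.elim (fun _ => 0) fun q => ω q.2 (if q.1 = i₀ then r i₀ - r i₁ else 0)
  obtain ⟨t, ht0, ht1, hinf, p, hp0, hp⟩ := exists_first_infeasible φ₀ φ₁
    ⟨z i₀, by
      rintro ((a | a) | ⟨j, s⟩)
      · simpa [φ₀, φ₁] using hzf i₀ a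
      · simpa [φ₀, φ₁] using hεz i₀ a
      · by_cases hj : j = i₀
        · simpa [φ₀, φ₁, hj] using hzω i₀ i₁ hne.symm s
        · simpa [φ₀, φ₁, hj] using hzω i₀ j hj s⟩
    (by
      rintro ⟨x, hx⟩
      refine hno ⟨x, fun a => by simpa [φ₀, φ₁] using hx (.inl (.inl a)), fun j s => ?_⟩
      have := hx (.inr (j, s))
      by_cases hj : j = i₀
      · simpa [φ₀, φ₁, hj] using this
      · simpa [φ₀, φ₁, hj] using this)
  set ρ : R → U := fun j => if j = i₀ then (1 - t) • r i₁ + t • r i₀ else r j with hρ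
  have hρne : ∀ j, j ≠ i₀ → ρ j = r j := fun j hj => by simp [hρ, hj]
  have hρ0 : ρ i₀ = (1 - t) • r i₁ + t • r i₀ := by simp [hρ]
  have hφr : ∀ j s, φ₀ (.inr (j, s)) + t • φ₁ (.inr (j, s)) = ω s (ρ j) := fun j s => by
    by_cases hj : j = i₀
    · ext x
      simp [φ₀, φ₁, hρ, hj]
      ring
    · simp [φ₀, φ₁, hρ, hj]
  have hφl : ∀ a l, 0 < (φ₀ (.inl a) + t • φ₁ (.inl a)) (z l) := by
    rintro (a | a) l
    · simpa [φ₀, φ₁] using hzf l a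
    · simpa [φ₀, φ₁] using hεz l a
  obtain ⟨I, c, hIne, hI, hIcard, hIsum⟩ :=
    exists_small_dependence_of_infeasible _ hinf hp0 hp
  have hsum : ∀ x, ∑ a ∈ I, c a * (φ₀ a + t • φ₁ a) x = 0 := fun x => by
    have := congrArg (fun l : Module.Dual ℝ U => l x) hIsum
    simpa only [LinearMap.sum_apply, LinearMap.smul_apply, smul_eq_mul,
      LinearMap.zero_apply] using this
  have hex : ∀ x, ∃ a ∈ I, (φ₀ a + t • φ₁ a) x ≤ 0 := fun x => by
    by_contra hcon
    push Not at hcon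
    exact absurd (hsum x) (Finset.sum_pos (fun a ha => mul_pos (hI a ha).1 (hcon a ha)) hIne).ne'
  -- `z l` satisfies all constraints but those of `l`, so the dependence involves `l`. The index
  -- `i₁` is excluded because `r i₁` also enters `ρ i₀`.
  have hmemI : ∀ l, l ≠ i₁ → ∃ s, Sum.inr (l, s) ∈ I := by
    intro l hl
    obtain ⟨a, haI, ha⟩ := hex (z l)
    obtain a | ⟨j, s⟩ := a
    · exact absurd ha (not_le.2 (hφl a l))
    · refine ⟨s, ?_⟩
      rw [hφr] at ha
      by_cases hjl : j = l
      · rwa [← hjl]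
      · exfalso
        refine absurd ha (not_le.2 ?_)
        by_cases hj : j = i₀
        · subst hj
          have e1 := hzω l i₁ hl.symm s
          have e2 := hzω l j hjl s
          rw [hρ0]
          simp only [map_add, map_smul, LinearMap.add_apply, LinearMap.smul_apply, smul_eq_mul]
          rcases ht0.eq_or_lt with rfl | ht0
          · simpa using e1
          · exact add_pos_of_nonneg_of_pos (mul_nonneg (by linarith) e1.le) (mul_pos ht0 e2)
        · rw [hρne j hj]
          exact hzω l j hjl s
  by_cases hb : ∃ b, Sum.inl b ∈ I
  · obtain ⟨b, hb⟩ := hb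
    have : Nonempty S := (hmemI i₀ hne).nonempty
    choose! σ hσ using hmemI
    -- One constraint `b` and one for each `j ≠ i₁` already exhaust the bound `dim U ≤ card R`;
    -- hence `i₀` enters through `σ i₀` alone.
    set I' : Finset ((T ⊕ T) ⊕ (R × S)) :=
      insert (.inl b) ((Finset.univ.erase i₁).image fun j => .inr (j, σ j)) with hI'
    have hI'I : I' ⊆ I := by
      rw [hI', Finset.insert_subset_iff]
      refine ⟨hb, fun a ha => ?_⟩
      obtain ⟨j, hj, rfl⟩ := Finset.mem_image.1 ha
      exact hσ j (Finset.ne_of_mem_erase hj)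
    have hI'card : I'.card = Fintype.card R := by
      rw [hI', Finset.card_insert_of_notMem (by simp), Finset.card_image_of_injective]
      · rw [Finset.card_erase_of_mem (Finset.mem_univ _), Finset.card_univ]
        omega
      · intro j j' hjj'
        simpa using congrArg (fun a : (T ⊕ T) ⊕ (R × S) => a.elim (fun _ => i₀) Prod.fst) hjj'
    have hII : I' = I := Finset.eq_of_subset_of_card_le hI'I (by omega)
    have hneg : ∀ l, (l = i₀ ∨ l = i₁) → ω (σ i₀) (ρ i₀) (z l) < 0 := by
      intro l hl
      by_contra hge
      push Not at hge
      refine absurd (hsum (z l)) (Finset.sum_pos' ?_ ⟨_, hb, mul_pos (hI _ hb).1 (hφl b l)⟩).ne'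
      intro a ha
      refine mul_nonneg (hI a ha).1.le ?_
      rw [← hII, hI', Finset.mem_insert, Finset.mem_image] at ha
      rcases ha with rfl | ⟨j, hj, rfl⟩
      · exact (hφl b l).le
      · rw [hφr]
        by_cases hj0 : j = i₀
        · rw [hj0]; exact hge
        · rw [hρne j hj0]
          refine (hzω l j ?_ _).le
          rcases hl with rfl | rfl
          · exact hj0
          · exact Finset.ne_of_mem_erase hj
    have n0 := hneg i₀ (.inl rfl)
    have n1 := hneg i₁ (.inr rfl)
    rw [hρ0] at n0 n1
    simp only [map_add, map_smul, LinearMap.add_apply, LinearMap.smul_apply, smul_eq_mul] at n0 n1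
    -- In the coordinate `σ i₀` this gives `r i₁ < z i₀ < r i₀` and also `r i₀ < z i₁ < r i₁`.
    have a0 := hzω i₀ i₁ hne.symm (σ i₀)
    have a1 := hzω i₁ i₀ hne (σ i₀)
    have b0 : ω (σ i₀) (r i₀) (z i₀) < 0 := by
      by_contra hge
      push Not at hge
      have := mul_nonneg (sub_nonneg.2 ht1) a0.le
      have := mul_nonneg ht0 hge
      linarith
    have b1 : ω (σ i₀) (r i₁) (z i₁) < 0 := by
      by_contra hge
      push Not at hge
      have := mul_nonneg (sub_nonneg.2 ht1) hge
      have := mul_nonneg ht0 a1.le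
      linarith
    have e0 := hω (σ i₀) (r i₁) (z i₀) (r i₀)
    have e1 := hω (σ i₀) (r i₀) (z i₁) (r i₁)
    rw [hanti _ (z i₀) (r i₀)] at e0
    rw [hanti _ (z i₁) (r i₁)] at e1
    have p0 := mul_pos (hr i₁ (h (σ i₀))) (neg_pos.2 b0)
    have p1 := mul_pos (hr i₀ (h (σ i₀))) a0
    have p2 := mul_pos (hr i₀ (h (σ i₀))) (neg_pos.2 b1)
    have p3 := mul_pos (hr i₁ (h (σ i₀))) a1
    rw [hanti _ (r i₀) (r i₁)] at e0
    have q0 : 0 < ω (σ i₀) (r i₁) (r i₀) := by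
      by_contra hle
      push Not at hle
      have := mul_nonneg (hzf i₀ (h (σ i₀))).le (neg_nonneg.2 hle)
      linarith
    have q1 := mul_pos (hzf i₁ (h (σ i₀))) q0
    linarith
  · push Not at hb
    have hpf : ∀ a, 0 ≤ f a p := fun a => by simpa [φ₀, φ₁] using hp (.inl (.inl a))
    have hpg : ∀ a, 0 ≤ f a p - ε * ℓ p := fun a => by
      simpa [φ₀, φ₁] using hp (.inl (.inr a))
    have hpr : ∀ j s, 0 ≤ ω s (ρ j) p := fun j s => by
      rw [← hφr]; exact hp (.inr (j, s))
    have hpr1 : ∀ s, 0 ≤ ω s (r i₁) p := fun s => by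
      rw [← hρne i₁ hne.symm]; exact hpr i₁ s
    have hℓp : 0 < ℓ p := by
      have hval : ℓ p = ∑ a, f a p + ∑ s, ω s (r i₁) p := by
        simp [hℓ, LinearMap.sum_apply]
      have s1 : 0 ≤ ∑ a, f a p := Finset.sum_nonneg fun a _ => hpf a
      have s2 : 0 ≤ ∑ s, ω s (r i₁) p := Finset.sum_nonneg fun s _ => hpr1 s
      refine (hval ▸ add_nonneg s1 s2 : 0 ≤ ℓ p).lt_of_ne' fun h0 => hp0 ?_
      rw [hval] at h0
      have t1 : ∑ a, f a p = 0 := by linarith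
      have t2 : ∑ s, ω s (r i₁) p = 0 := by linarith
      rw [Finset.sum_eq_zero_iff_of_nonneg fun a _ => hpf a] at t1
      rw [Finset.sum_eq_zero_iff_of_nonneg fun s _ => hpr1 s] at t2
      exact hpt i₁ p (fun a => t1 a (Finset.mem_univ _)) fun s => t2 s (Finset.mem_univ _)
    have hfp : ∀ a, 0 < f a p := fun a => by
      have := hpg a
      have := mul_pos hε hℓp
      linarith
    have hfρ : ∀ j a, 0 < f a (ρ j) := fun j a => by
      by_cases hj : j = i₀
      · rw [hj, hρ0]
        simp only [map_add, map_smul, smul_eq_mul]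
        rcases ht0.eq_or_lt with rfl | ht0
        · simpa using hr i₁ a
        · exact add_pos_of_nonneg_of_pos (mul_nonneg (by linarith) (hr i₁ a).le)
            (mul_pos ht0 (hr i₀ a))
      · rw [hρne j hj]; exact hr j a
    have hprop : ∀ s u, ω s u p = 0 → ∀ q, f (h s) u * ω s p q = f (h s) p * ω s u q := by
      intro s u hu q
      have e := hω s u p q
      rw [hu, hanti s q u] at e
      linarith
    have hzero : ∀ s j, Sum.inr (j, s) ∈ I → ω s (ρ j) p = 0 := fun s j hjs => by
      have := (hI _ hjs).2
      rwa [hφr] at this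
    -- `r i₁` lies weakly below `p`, which agrees with `ρ j` in each active coordinate `s`. So all
    -- terms of the dependence at `r i₁` are nonpositive, hence zero, and `r i₁` agrees with `p`
    -- there.
    have hkey : ∀ s j, Sum.inr (j, s) ∈ I → ω s (r i₁) p = 0 := by
      have hle : ∀ a ∈ I, c a * (φ₀ a + t • φ₁ a) (r i₁) ≤ 0 := by
        rintro (b | ⟨j, s⟩) ha
        · exact absurd ha (hb b)
        · rw [hφr]
          refine mul_nonpos_of_nonneg_of_nonpos (hI _ ha).1.le ?_
          have e := hprop s _ (hzero s j ha) (r i₁)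
          rw [hanti s p] at e
          by_contra hgt
          push Not at hgt
          have := mul_pos (hfp (h s)) hgt
          have := mul_nonneg (hfρ j (h s)).le (hpr1 s)
          linarith
      have hz := (Finset.sum_eq_zero_iff_of_nonpos hle).1 (hsum (r i₁))
      intro s j hjs
      have e := hprop s _ (hzero s j hjs) (r i₁)
      have e1 := hz _ hjs
      rw [hφr] at e1
      rw [(mul_eq_zero.1 e1).resolve_left (hI _ hjs).1.ne', mul_zero, hanti s p, mul_neg,
        neg_eq_zero] at e
      exact (mul_eq_zero.1 e).resolve_left (hfρ j (h s)).ne'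
    -- Since `z i₀` is strictly above `r i₁`, it is above `ρ j` in every active coordinate, so no
    -- term of the dependence can be nonpositive.
    obtain ⟨a, haI, ha⟩ := hex (z i₀)
    obtain b | ⟨j, s⟩ := a
    · exact hb b haI
    · rw [hφr] at ha
      have e := hprop s _ (hzero s j haI) (z i₀)
      have e' := hprop s _ (hkey s j haI) (z i₀)
      have g1 := mul_pos (hfp (h s)) (hzω i₀ i₁ hne.symm s)
      rw [← e'] at g1
      have g2 := pos_of_mul_pos_right g1 (hr i₁ (h s)).le
      have g3 := mul_pos (hfρ j (h s)) g2
      rw [e] at g3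
      exact absurd (pos_of_mul_pos_right g3 (hfp (h s)).le) (not_lt.2 ha)

end CausalHelly

/-! ### Intersecting cones of coloured vector configurations. -/

section ColouredConfigurations

variable {U : Type*} [AddCommGroup U] [Module ℝ U] {ι : Type*} {κ : ι → Type*}
  {y : ∀ i, κ i → U} {b : (∀ i, κ i) → Module.Basis ι ℝ U}

/-- Some point lies in the interior of the simplicial cone spanned by `y i (τ i)`, for each
transversal `τ` with colours restricted to `A`. -/
def ConesMeet (b : (∀ i, κ i) → Module.Basis ι ℝ U) (A : ∀ i, Finset (κ i)) : Prop :=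
  ∃ z, ∀ τ : ∀ i, κ i, (∀ i, τ i ∈ A i) → ∀ i, 0 < (b τ).coord i z

/-- Both functionals vanish on the basis vectors common to the two transversals, hence are
proportional. -/
theorem coord_eq_mul_coord (hb : ∀ τ i, b τ i = y i (τ i)) {τ τ' : ∀ i, κ i} {i : ι}
    (h : ∀ j, j ≠ i → τ' j = τ j) (z : U) :
    (b τ).coord i z = (b τ).coord i (y i (τ' i)) * (b τ').coord i z := by
  classical
  have : (b τ).coord i = (b τ).coord i (y i (τ' i)) • (b τ').coord i := by
    refine (b τ').ext fun j => ?_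
    by_cases hj : j = i
    · subst hj
      rw [LinearMap.smul_apply, (b τ').coord_apply, Module.Basis.repr_self,
        Finsupp.single_eq_same, smul_eq_mul, mul_one, hb]
    · have e : b τ' j = b τ j := by rw [hb, hb, h j hj]
      rw [LinearMap.smul_apply, (b τ').coord_apply, Module.Basis.repr_self, e,
        Module.Basis.coord_apply, Module.Basis.repr_self]
      simp [hj]
  conv_lhs => rw [this]
  rfl

/-- If one colour class has at least `card ι` members and the cones meet after removal of any one
of them, then the cones meet. -/
theorem conesMeet_of_erase [Fintype ι] [DecidableEq ι] [∀ i, DecidableEq (κ i)]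
    (hb : ∀ τ i, b τ i = y i (τ i)) (hpos : ∀ τ i m, 0 < (b τ).coord i (y i m))
    {A : ∀ i, Finset (κ i)} (hA : ∀ i, (A i).Nonempty) {i₀ : ι}
    (hcard : Fintype.card ι ≤ (A i₀).card) (h2 : 2 ≤ (A i₀).card)
    (hsub : ∀ m ∈ A i₀, ConesMeet b (Function.update A i₀ ((A i₀).erase m))) :
    ConesMeet b A := by
  classical
  choose τ₀ hτ₀ using hA
  have : FiniteDimensional ℝ U := (b τ₀).finiteDimensional_of_finite
  have hupd : ∀ {τ : ∀ i, κ i}, (∀ i, τ i ∈ A i) → ∀ m ∈ A i₀,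
      ∀ i, Function.update τ i₀ m i ∈ A i := by
    intro τ hτ m hm i
    by_cases hi : i = i₀
    · subst hi; simpa using hm
    · simpa [hi] using hτ i
  let Tr := {τ : ∀ i, κ i // τ ∈ Fintype.piFinset A}
  have hTr : ∀ τ : Tr, ∀ i, τ.1 i ∈ A i := fun τ => Fintype.mem_piFinset.1 τ.2
  let f : Tr → Module.Dual ℝ U := fun τ => (b τ.1).coord i₀
  -- Up to the factor `coord i₀ u * coord i₀ v`, this is the difference of the affine coordinates
  -- `coord l / coord i₀` of `v` and `u`.
  let ω : {l // l ≠ i₀} × Tr → U →ₗ[ℝ] U →ₗ[ℝ] ℝ := fun s =>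
    ((b s.2.1).coord i₀).smulRight ((b s.2.1).coord s.1.1) -
      ((b s.2.1).coord s.1.1).smulRight ((b s.2.1).coord i₀)
  have hωa : ∀ s u v, ω s u v = (b s.2.1).coord i₀ u * (b s.2.1).coord s.1.1 v -
      (b s.2.1).coord s.1.1 u * (b s.2.1).coord i₀ v := fun s u v => rfl
  -- `ω s (y i₀ m)` vanishes at `y i₀ m` by skew symmetry and at the other shared basis vectors
  -- except the `l`-th. Thus it tests the cone of the transversal with `m` exchanged in.
  have hωr : ∀ s m v, ω s (y i₀ m) v =
      (b s.2.1).coord i₀ (y i₀ m) * (b (Function.update s.2.1 i₀ m)).coord s.1.1 v := by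
    rintro ⟨⟨l, hl⟩, τ⟩ m v
    have : ω (⟨l, hl⟩, τ) (y i₀ m) =
        (b τ.1).coord i₀ (y i₀ m) • (b (Function.update τ.1 i₀ m)).coord l := by
      refine (b (Function.update τ.1 i₀ m)).ext fun j => ?_
      rw [hωa, LinearMap.smul_apply, (b (Function.update τ.1 i₀ m)).coord_apply,
        Module.Basis.repr_self]
      dsimp only
      by_cases hj : j = i₀
      · subst hj
        simp only [hb, Function.update_self, smul_eq_mul]
        rw [Finsupp.single_eq_of_ne (by simpa using hl)]
        ring
      · have e : b (Function.update τ.1 i₀ m) j = b τ.1 j := by simp [hb, hj]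
        rw [e, Module.Basis.coord_apply, Module.Basis.coord_apply, Module.Basis.coord_apply,
          Module.Basis.coord_apply, Module.Basis.repr_self, Finsupp.single_eq_of_ne (Ne.symm hj)]
        simp
    rw [this]; rfl
  have hfin := Module.finrank_eq_card_basis (b τ₀)
  obtain ⟨z, hzf, hzω⟩ := exists_common_upper_bound (fun m : A i₀ => y i₀ m) f ω Prod.snd
    (fun s u v => by rw [hωa, hωa]; ring)
    (fun s u v w => by rw [hωa, hωa, hωa]; simp only [f]; ring)
    (fun m τ => hpos _ _ _)
    (by
      rintro ⟨m, hm⟩ p hp hpω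
      have hτm := hupd hτ₀ m hm
      let τ : Tr := ⟨Function.update τ₀ i₀ m, Fintype.mem_piFinset.2 hτm⟩
      refine (b τ.1).ext_elem fun i => ?_
      rw [map_zero, Finsupp.zero_apply]
      by_cases hi : i = i₀
      · subst hi
        exact hp τ
      · have h := hpω (⟨i, hi⟩, τ)
        rw [hωr] at h
        have e : Function.update τ.1 i₀ m = τ.1 := by simp [τ]
        dsimp only at h
        rw [e] at h
        exact (mul_eq_zero.1 h).resolve_left (hpos _ _ _).ne')
    (by rw [hfin, Fintype.card_coe]; exact hcard) (by rw [Fintype.card_coe]; exact h2)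
    (by
      rintro ⟨m, hm⟩
      obtain ⟨z, hz⟩ := hsub m hm
      have hz' : ∀ τ : Tr, ∀ m' ∈ A i₀, m' ≠ m →
          ∀ i, 0 < (b (Function.update τ.1 i₀ m')).coord i z := by
        intro τ m' hm' hne
        refine hz _ fun i => ?_
        by_cases hi : i = i₀
        · subst hi
          simp [hne, hm']
        · simpa [hi] using hTr τ i
      obtain ⟨m', hm', hne⟩ := Finset.exists_mem_ne (s := A i₀) (by omega) m
      refine ⟨z, fun τ => ?_, fun j hj s => ?_⟩
      -- The sign of `coord i₀` is the same for transversals that differ only at `i₀`, so it can be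
      -- tested with `m' ≠ m`.
      · have := coord_eq_mul_coord hb (τ := τ.1) (τ' := Function.update τ.1 i₀ m') (i := i₀)
          (fun j hj => by simp [hj]) z
        simp only [f]
        rw [this]
        exact mul_pos (hpos _ _ _) (hz' τ m' hm' hne i₀)
      · rw [hωr]
        exact mul_pos (hpos _ _ _) (hz' s.2 j j.2 (fun h => hj (Subtype.ext h)) _))
  refine ⟨z, fun τ hτ i => ?_⟩
  let τ' : Tr := ⟨τ, Fintype.mem_piFinset.2 hτ⟩
  by_cases hi : i = i₀
  · subst hi
    exact hzf τ'
  · have h := hzω ⟨τ i₀, hτ i₀⟩ (⟨i, hi⟩, τ')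
    rw [hωr] at h
    have h' := pos_of_mul_pos_right h (hpos _ _ _).le
    simpa [τ'] using h'

/-- If the cones meet for every choice of colour subclasses with at most `card ι - 1` members
each, then they meet. -/
theorem conesMeet_of_small [Fintype ι] [DecidableEq ι] [∀ i, DecidableEq (κ i)]
    (hb : ∀ τ i, b τ i = y i (τ i)) (hpos : ∀ τ i m, 0 < (b τ).coord i (y i m))
    (hι : 2 ≤ Fintype.card ι)
    (hsmall : ∀ A : ∀ i, Finset (κ i), (∀ i, (A i).Nonempty) →
      (∀ i, (A i).card ≤ Fintype.card ι - 1) → ConesMeet b A)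
    (A : ∀ i, Finset (κ i)) (hA : ∀ i, (A i).Nonempty) : ConesMeet b A := by
  induction hN : ∑ i, (A i).card using Nat.strong_induction_on generalizing A with
  | _ N ih =>
    by_cases hle : ∀ i, (A i).card ≤ Fintype.card ι - 1
    · exact hsmall A hA hle
    · push Not at hle
      obtain ⟨i₀, hi₀⟩ := hle
      refine conesMeet_of_erase hb hpos hA (i₀ := i₀) (by omega) (by omega) fun m hm => ?_
      have hcard := Finset.card_erase_of_mem hm
      refine ih _ ?_ _ (fun i => ?_) rfl
      · rw [← hN]
        refine Finset.sum_lt_sum (fun i _ => ?_) ⟨i₀, Finset.mem_univ _, ?_⟩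
        · by_cases hi : i = i₀
          · subst hi; simp only [Function.update_self]; omega
          · simp [hi]
        · simp only [Function.update_self]; omega
      · by_cases hi : i = i₀
        · subst hi
          simp only [Function.update_self]
          rw [← Finset.card_pos]; omega
        · simpa [hi] using hA i

end ColouredConfigurations

/-! ### Facets of the join as complements of transversals. -/

section Facets

variable {k : ℕ} {n : Fin k → ℕ}

/-- The facet of the join of the boundaries of simplices that is complementary to the
transversal `τ`. -/
def transversalFacet (τ : ∀ i, Fin (n i + 1)) : Finset (Σ i, Fin (n i + 1)) :=
  Finset.univ.filter fun v => v.2 ≠ τ v.1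

@[simp]
theorem mem_transversalFacet {τ : ∀ i, Fin (n i + 1)} {v : Σ i, Fin (n i + 1)} :
    v ∈ transversalFacet τ ↔ v.2 ≠ τ v.1 := by
  simp [transversalFacet]

theorem card_transversalFacet (τ : ∀ i, Fin (n i + 1)) :
    (transversalFacet τ).card = ∑ i, n i := by
  have : transversalFacet τ = Finset.univ.sigma fun i => Finset.univ.erase (τ i) := by
    ext v; simp
  rw [this, Finset.card_sigma]
  simp

theorem mem_joinComplex_simplexBoundary_iff {s : Finset (Σ i, Fin (n i + 1))} :
    s ∈ joinComplex (fun i => simplexBoundary (n i)) ↔ ∃ τ, s ⊆ transversalFacet τ := by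
  constructor
  · rintro ⟨t, ht, rfl⟩
    have : ∀ i, ∃ m, m ∉ t i := fun i => by
      by_contra h
      push Not at h
      exact ht i (Finset.eq_univ_iff_forall.2 h)
    choose τ hτ using this
    refine ⟨τ, fun v hv => ?_⟩
    rw [mem_transversalFacet]
    intro h
    exact hτ v.1 (h ▸ (Finset.mem_sigma.1 hv).2)
  · rintro ⟨τ, hτ⟩
    refine ⟨fun i => Finset.univ.filter fun m => (⟨i, m⟩ : Σ i, Fin (n i + 1)) ∈ s,
      fun i h => ?_, ?_⟩
    · have : τ i ∈ Finset.univ.filter fun m => (⟨i, m⟩ : Σ i, Fin (n i + 1)) ∈ s :=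
        h.ge (Finset.mem_univ _)
      have := hτ (Finset.mem_filter.1 this).2
      simp at this
    · ext ⟨i, m⟩; simp

end Facets

/-! ### Full-dimensional cones of the fan and their walls. -/

section FanCones

variable {V : Type*} [AddCommGroup V] [Module ℝ V]

theorem sum_smul_mem_hull {ν : Type*} (x : ν → V) (s : Finset ν) (c : ν → ℝ)
    (hc : ∀ v ∈ s, 0 ≤ c v) : ∑ v ∈ s, c v • x v ∈ PointedCone.hull ℝ (x '' (s : Set ν)) :=
  Submodule.sum_mem _ fun v hv => Submodule.smul_mem _ (⟨c v, hc v hv⟩ : NNReal)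
    (Submodule.subset_span ⟨v, hv, rfl⟩)

/-- A cone of a fan that contains a relatively interior point of another one contains all of it. -/
theorem IsFan.hull_le_of_pos_combination {𝓕 : Set (PointedCone ℝ V)} (h : IsFan 𝓕)
    {ν : Type*} {x : ν → V} {s : Finset ν} (hs : PointedCone.hull ℝ (x '' (s : Set ν)) ∈ 𝓕)
    {D : PointedCone ℝ V} (hD : D ∈ 𝓕) {c : ν → ℝ} (hc : ∀ v ∈ s, 0 < c v)
    (hq : ∑ v ∈ s, c v • x v ∈ D) : PointedCone.hull ℝ (x '' (s : Set ν)) ≤ D := by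
  obtain ⟨⟨g, hg0, hg⟩, -⟩ := h.inter_face _ hs D hD
  have hgq := ((hg _).1 ⟨sum_smul_mem_hull x s c fun v hv => (hc v hv).le, hq⟩).2
  have hmem : ∀ v ∈ s, x v ∈ PointedCone.hull ℝ (x '' (s : Set ν)) := fun v hv =>
    Submodule.subset_span ⟨v, hv, rfl⟩
  simp only [map_sum, map_smul, smul_eq_mul] at hgq
  rw [Finset.sum_eq_zero_iff_of_nonneg fun v hv => mul_nonneg (hc v hv).le (hg0 _ (hmem v hv))]
    at hgq
  refine Submodule.span_le.2 ?_
  rintro _ ⟨v, hv, rfl⟩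
  exact ((hg _).2 ⟨hmem v hv, (mul_eq_zero.1 (hgq v hv)).resolve_left (hc v hv).ne'⟩).2

variable {k : ℕ} {n : Fin k → ℕ} {𝓕 : Set (PointedCone ℝ V)} {x : (Σ i : Fin k, Fin (n i + 1)) → V}

theorem IsFanOver.linearIndependent_facet
    (h : IsFanOver 𝓕 (joinComplex fun i => simplexBoundary (n i)) x) (τ : ∀ i, Fin (n i + 1)) :
    LinearIndependent ℝ fun v : transversalFacet τ => x v :=
  h.linearIndepOn _ (mem_joinComplex_simplexBoundary_iff.2 ⟨τ, subset_rfl⟩)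

theorem IsFanOver.facet_mem
    (h : IsFanOver 𝓕 (joinComplex fun i => simplexBoundary (n i)) x) (τ : ∀ i, Fin (n i + 1)) :
    PointedCone.hull ℝ (x '' (transversalFacet τ : Set _)) ∈ 𝓕 := by
  rw [h.cones_eq]
  exact ⟨_, mem_joinComplex_simplexBoundary_iff.2 ⟨τ, subset_rfl⟩, rfl⟩

theorem IsFanOver.exists_mem_facet
    (h : IsFanOver 𝓕 (joinComplex fun i => simplexBoundary (n i)) x) (hc : IsCompleteFan 𝓕)
    (v : V) :
    ∃ τ : ∀ i, Fin (n i + 1), v ∈ PointedCone.hull ℝ (x '' (transversalFacet τ : Set _)) := by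
  obtain ⟨C, hC, hv⟩ := hc.2 v
  rw [h.cones_eq] at hC
  obtain ⟨s, hs, rfl⟩ := hC
  obtain ⟨τ, hτ⟩ := mem_joinComplex_simplexBoundary_iff.1 hs
  exact ⟨τ, Submodule.span_mono (Set.image_mono (Finset.coe_subset.2 hτ)) hv⟩

/-- A real vector space is not a finite union of proper subspaces, so some facet spans; all facets
have equally many independent generators. -/
theorem IsFanOver.span_facet
    (h : IsFanOver 𝓕 (joinComplex fun i => simplexBoundary (n i)) x) (hc : IsCompleteFan 𝓕)
    (τ : ∀ i, Fin (n i + 1)) :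
    Submodule.span ℝ (Set.range fun v : transversalFacet τ => x v) = ⊤ := by
  classical
  obtain ⟨τ₀, hτ₀⟩ := Subspace.exists_eq_top_of_iUnion_eq_univ (k := ℝ) (E := V)
    (p := fun τ : ∀ i, Fin (n i + 1) => Submodule.span ℝ (x '' (transversalFacet τ : Set _))) (by
      rw [Set.eq_univ_iff_forall]
      intro v
      obtain ⟨τ, hv⟩ := h.exists_mem_facet hc v
      exact Set.mem_iUnion.2 ⟨τ, PointedCone.hull_le_span ℝ _ hv⟩)
  have : FiniteDimensional ℝ V := ⟨⟨(transversalFacet τ₀).image x, by simpa using hτ₀⟩⟩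
  have e : Set.range (fun v : transversalFacet τ₀ => x v) =
      x '' (transversalFacet τ₀ : Set _) := by
    ext; simp
  have h1 := finrank_span_eq_card (h.linearIndependent_facet τ₀)
  rw [e, hτ₀, finrank_top, Fintype.card_coe, card_transversalFacet] at h1
  rcases isEmpty_or_nonempty (transversalFacet τ) with hemp | hne
  · have h2 : (transversalFacet τ).card = 0 := by rw [← Fintype.card_coe, Fintype.card_eq_zero]
    rw [card_transversalFacet, ← h1] at h2
    have := Module.finrank_zero_iff.1 h2
    exact Subsingleton.elim _ _
  · exact (h.linearIndependent_facet τ).span_eq_top_of_card_eq_finrank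
      (by rw [Fintype.card_coe, card_transversalFacet, h1])

/-- The basis of the ambient space formed by the generators of a full-dimensional cone. -/
noncomputable def IsFanOver.facetBasis
    (h : IsFanOver 𝓕 (joinComplex fun i => simplexBoundary (n i)) x) (hc : IsCompleteFan 𝓕)
    (τ : ∀ i, Fin (n i + 1)) : Module.Basis (transversalFacet τ) ℝ V :=
  Module.Basis.mk (h.linearIndependent_facet τ) (h.span_facet hc τ).ge

/-- The linear functional with prescribed values at the generators of a full-dimensional cone. -/
noncomputable def IsFanOver.facetDual
    (h : IsFanOver 𝓕 (joinComplex fun i => simplexBoundary (n i)) x) (hc : IsCompleteFan 𝓕)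
    (τ : ∀ i, Fin (n i + 1)) (a : (Σ i : Fin k, Fin (n i + 1)) → ℝ) : Module.Dual ℝ V :=
  (h.facetBasis hc τ).constr ℝ fun v => a v

variable {τ : ∀ i, Fin (n i + 1)}

theorem IsFanOver.facetBasis_apply
    (h : IsFanOver 𝓕 (joinComplex fun i => simplexBoundary (n i)) x) (hc : IsCompleteFan 𝓕)
    (v : transversalFacet τ) : h.facetBasis hc τ v = x v := by
  simp [IsFanOver.facetBasis]

theorem IsFanOver.facetDual_apply
    (h : IsFanOver 𝓕 (joinComplex fun i => simplexBoundary (n i)) x) (hc : IsCompleteFan 𝓕)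
    (a : (Σ i : Fin k, Fin (n i + 1)) → ℝ)
    {v : Σ i : Fin k, Fin (n i + 1)} (hv : v ∈ transversalFacet τ) :
    h.facetDual hc τ a (x v) = a v := by
  have := (h.facetBasis hc τ).constr_basis ℝ (fun v => a v) ⟨v, hv⟩
  rwa [h.facetBasis_apply hc] at this

theorem IsFanOver.dual_ext
    (h : IsFanOver 𝓕 (joinComplex fun i => simplexBoundary (n i)) x) (hc : IsCompleteFan 𝓕)
    {ψ ψ' : Module.Dual ℝ V}
    (hψ : ∀ v ∈ transversalFacet τ, ψ (x v) = ψ' (x v)) : ψ = ψ' :=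
  (h.facetBasis hc τ).ext fun v => by
    rw [h.facetBasis_apply hc]; exact hψ v v.2

theorem IsFanOver.exists_eq_sum
    (h : IsFanOver 𝓕 (joinComplex fun i => simplexBoundary (n i)) x) (hc : IsCompleteFan 𝓕)
    (w : V) : ∃ β : (Σ i : Fin k, Fin (n i + 1)) → ℝ,
    w = ∑ v ∈ transversalFacet τ, β v • x v := by
  refine ⟨fun v => if hv : v ∈ transversalFacet τ then (h.facetBasis hc τ).repr w ⟨v, hv⟩ else 0,
    ?_⟩
  conv_lhs => rw [← (h.facetBasis hc τ).sum_repr w]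
  refine Eq.trans ?_ (Finset.sum_coe_sort (transversalFacet τ) _)
  refine Finset.sum_congr rfl fun v _ => ?_
  rw [h.facetBasis_apply hc]
  simp only [v.2, dif_pos]

/-- The generators of the two vertices in which two adjacent full-dimensional cones differ lie
strictly on opposite sides of their common wall. -/
theorem IsFanOver.facetDual_neg
    (h : IsFanOver 𝓕 (joinComplex fun i => simplexBoundary (n i)) x) (hc : IsCompleteFan 𝓕)
    {i : Fin k} {m : Fin (n i + 1)} (hm : m ≠ τ i) :
    h.facetDual hc τ (Pi.single ⟨i, m⟩ 1) (x ⟨i, τ i⟩) < 0 := by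
  classical
  set ψ := h.facetDual hc τ (Pi.single ⟨i, m⟩ 1) with hψ
  have hm' : (⟨i, m⟩ : Σ i, Fin (n i + 1)) ∈ transversalFacet τ := by simpa using hm
  have hψm : ψ (x ⟨i, m⟩) = 1 := by rw [hψ, h.facetDual_apply hc _ hm']; simp
  have hψv : ∀ v ∈ transversalFacet τ, v ≠ ⟨i, m⟩ → ψ (x v) = 0 := fun v hv hne => by
    rw [hψ, h.facetDual_apply hc _ hv, Pi.single_eq_of_ne hne]
  set τ' := Function.update τ i m with hτ'
  have hw' : (⟨i, τ i⟩ : Σ i, Fin (n i + 1)) ∈ transversalFacet τ' := by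
    simpa [hτ'] using hm.symm
  have hF : ∀ v : Σ i, Fin (n i + 1), v ≠ ⟨i, m⟩ → v ≠ ⟨i, τ i⟩ →
      (v ∈ transversalFacet τ ↔ v ∈ transversalFacet τ') := by
    rintro ⟨j, l⟩ h1 h2
    by_cases hj : j = i
    · subst hj
      simp only [ne_eq, Sigma.mk.injEq, heq_eq_eq, true_and] at h1 h2
      simp [hτ', h1, h2]
    · simp [hτ', hj]
  have herase : (transversalFacet τ').erase ⟨i, τ i⟩ = (transversalFacet τ).erase ⟨i, m⟩ := by
    ext v
    simp only [Finset.mem_erase]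
    by_cases h1 : v = ⟨i, m⟩
    · subst h1; simp [hτ']
    · by_cases h2 : v = ⟨i, τ i⟩
      · subst h2; simp
      · simp only [h1, h2, ne_eq, not_false_eq_true, true_and, (hF v h1 h2)]
  obtain ⟨β, hβ⟩ := h.exists_eq_sum hc (τ := τ) (x ⟨i, τ i⟩)
  have hψβ : ψ (x ⟨i, τ i⟩) = β ⟨i, m⟩ := by
    rw [hβ, map_sum, Finset.sum_eq_single_of_mem _ hm']
    · simp [hψm]
    · intro v hv hne
      rw [map_smul, hψv v hv hne, smul_zero]
  by_contra hge
  push Not at hge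
  rcases hge.eq_or_lt with h0 | hpos
  -- Value zero would put the new generator in the span of the wall, against independence in `τ'`.
  · have h1 : h.facetDual hc τ' (Pi.single ⟨i, τ i⟩ 1) (x ⟨i, τ i⟩) = 1 := by
      rw [h.facetDual_apply hc _ hw']; simp
    rw [hβ, map_sum, Finset.sum_eq_zero] at h1
    · exact zero_ne_one h1
    · intro v hv
      by_cases hvm : v = ⟨i, m⟩
      · rw [hvm, ← hψβ, ← h0, zero_smul, map_zero]
      · have hv' : v ∈ (transversalFacet τ').erase ⟨i, τ i⟩ := by
          rw [herase]; exact Finset.mem_erase.2 ⟨hvm, hv⟩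
        rw [map_smul, h.facetDual_apply hc _ (Finset.mem_of_mem_erase hv'),
          Pi.single_eq_of_ne (Finset.ne_of_mem_erase hv'), smul_zero]
  -- Adding `N` times every wall generator to `hβ` gives one vector that is a positive combination
  -- over both facets, so the two cones coincide.
  · set N : ℝ := 1 + ∑ v, |β v| with hN
    have hNβ : ∀ v, 0 < β v + N := fun v => by
      have h1 := Finset.single_le_sum (f := fun v => |β v|) (fun v _ => abs_nonneg _)
        (Finset.mem_univ v)
      have h2 := neg_abs_le (β v)
      linarith
    have hNpos : 0 < N := by
      have := Finset.sum_nonneg (s := Finset.univ) fun v _ => abs_nonneg (β v)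
      linarith
    set c : (Σ i, Fin (n i + 1)) → ℝ := fun v => if v = ⟨i, m⟩ then β v else β v + N with hcdef
    set c' : (Σ i, Fin (n i + 1)) → ℝ := fun v => if v = ⟨i, τ i⟩ then 1 else N with hc'def
    have hcpos : ∀ v ∈ transversalFacet τ, 0 < c v := fun v _ => by
      by_cases hv : v = ⟨i, m⟩
      · simp only [hcdef, hv, if_true]; rw [← hψβ]; exact hpos
      · simp only [hcdef, hv, if_false]; exact hNβ v
    have hc'pos : ∀ v ∈ transversalFacet τ', 0 < c' v := fun v _ => by
      by_cases hv : v = ⟨i, τ i⟩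
      · simp [hc'def, hv]
      · simp only [hc'def, hv, if_false]; exact hNpos
    have heq : ∑ v ∈ transversalFacet τ, c v • x v = ∑ v ∈ transversalFacet τ', c' v • x v := by
      rw [← Finset.add_sum_erase _ _ hw', herase, ← Finset.add_sum_erase _ _ hm']
      have e1 : ∑ v ∈ (transversalFacet τ).erase ⟨i, m⟩, c v • x v =
          ∑ v ∈ (transversalFacet τ).erase ⟨i, m⟩, β v • x v +
          ∑ v ∈ (transversalFacet τ).erase ⟨i, m⟩, N • x v := by
        rw [← Finset.sum_add_distrib]
        refine Finset.sum_congr rfl fun v hv => ?_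
        simp only [hcdef, Finset.ne_of_mem_erase hv, if_false, add_smul]
      have e2 : ∑ v ∈ (transversalFacet τ).erase ⟨i, m⟩, c' v • x v =
          ∑ v ∈ (transversalFacet τ).erase ⟨i, m⟩, N • x v := by
        refine Finset.sum_congr rfl fun v hv => ?_
        rw [← herase] at hv
        simp only [hc'def, Finset.ne_of_mem_erase hv, if_false]
      have e3 := hβ
      rw [← Finset.add_sum_erase _ _ hm'] at e3
      rw [e1, e2, ← add_assoc]
      congr 1
      simp only [hcdef, hc'def, if_true, one_smul]
      exact e3.symm
    have hle1 := h.isFan.hull_le_of_pos_combination (h.facet_mem τ) (h.facet_mem τ') hcpos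
      (heq ▸ sum_smul_mem_hull x _ c' fun v hv => (hc'pos v hv).le)
    have hle2 := h.isFan.hull_le_of_pos_combination (h.facet_mem τ') (h.facet_mem τ) hc'pos
      (heq ▸ sum_smul_mem_hull x _ c fun v hv => (hcpos v hv).le)
    have hinj := h.injOn (mem_joinComplex_simplexBoundary_iff.2 ⟨τ, subset_rfl⟩)
      (mem_joinComplex_simplexBoundary_iff.2 ⟨τ', subset_rfl⟩) (le_antisymm hle1 hle2)
    rw [← hinj] at hw'
    simp at hw'

end FanCones

/-! ### The Gale dual and strictly convex support functions. -/

section GaleDual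

variable {V : Type*} [AddCommGroup V] [Module ℝ V] {ν : Type*}

/-- The evaluation of linear functionals at a vector configuration. -/
noncomputable def dualEval (x : ν → V) : Module.Dual ℝ V →ₗ[ℝ] ν → ℝ :=
  LinearMap.pi fun v => Module.Dual.eval ℝ V (x v)

@[simp]
theorem dualEval_apply (x : ν → V) (ψ : Module.Dual ℝ V) (v : ν) : dualEval x ψ v = ψ (x v) := rfl

/-- The ambient space of the Gale dual of a vector configuration: real functions on the index set
modulo the restrictions of linear functionals. -/
abbrev GaleSpace (x : ν → V) : Type _ := (ν → ℝ) ⧸ LinearMap.range (dualEval x)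

/-- The Gale dual of a vector configuration. -/
noncomputable def galeVector [DecidableEq ν] (x : ν → V) (v : ν) : GaleSpace x :=
  (LinearMap.range (dualEval x)).mkQ (Pi.single v 1)

variable {k : ℕ} {n : Fin k → ℕ} {𝓕 : Set (PointedCone ℝ V)} {x : (Σ i : Fin k, Fin (n i + 1)) → V}

theorem sum_smul_galeVector (τ : ∀ i, Fin (n i + 1)) (g : Fin k → ℝ) :
    ∑ i, g i • galeVector x ⟨i, τ i⟩ =
      (LinearMap.range (dualEval x)).mkQ fun v => if v.2 = τ v.1 then g v.1 else 0 := by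
  simp only [galeVector, ← map_smul, ← map_sum]
  congr 1
  ext ⟨j, m⟩
  rw [Finset.sum_apply, Finset.sum_eq_single j]
  · by_cases hm : m = τ j
    · simp [hm]
    · simp [hm]
  · intro i _ hij
    simp [Ne.symm hij]
  · simp

/-- Subtracting the restriction of `ψ` from `a` leaves a function supported on the omitted vertices.
-/
theorem mkQ_eq_sum_galeVector (τ : ∀ i, Fin (n i + 1))
    (a : (Σ i : Fin k, Fin (n i + 1)) → ℝ) {ψ : Module.Dual ℝ V}
    (hψ : ∀ v ∈ transversalFacet τ, ψ (x v) = a v) :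
    (LinearMap.range (dualEval x)).mkQ a =
      ∑ i, (a ⟨i, τ i⟩ - ψ (x ⟨i, τ i⟩)) • galeVector x ⟨i, τ i⟩ := by
  rw [sum_smul_galeVector, ← sub_eq_zero, ← map_sub]
  refine (Submodule.Quotient.mk_eq_zero _).2 ⟨ψ, ?_⟩
  ext ⟨j, m⟩
  by_cases hm : m = τ j
  · simp [hm]
  · simpa [hm] using hψ ⟨j, m⟩ (by simpa using hm)

/-- The Gale dual vectors of a transversal form a basis. -/
noncomputable def IsFanOver.galeBasis
    (h : IsFanOver 𝓕 (joinComplex fun i => simplexBoundary (n i)) x) (hc : IsCompleteFan 𝓕)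
    (τ : ∀ i, Fin (n i + 1)) : Module.Basis (Fin k) ℝ (GaleSpace x) :=
  Module.Basis.mk (v := fun i => galeVector x ⟨i, τ i⟩)
    (by
      rw [Fintype.linearIndependent_iff]
      intro g hg i
      rw [sum_smul_galeVector] at hg
      obtain ⟨ψ, hψ⟩ := (Submodule.Quotient.mk_eq_zero _).1 hg
      have hψ0 : ψ = 0 := h.dual_ext hc (τ := τ) fun v hv => by
        have := congrFun hψ v
        rw [dualEval_apply, if_neg (mem_transversalFacet.1 hv)] at this
        simpa using this
      have := congrFun hψ ⟨i, τ i⟩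
      simpa [hψ0] using this.symm)
    (by
      rintro z -
      obtain ⟨a, rfl⟩ := Submodule.mkQ_surjective _ z
      rw [mkQ_eq_sum_galeVector τ a fun v hv => h.facetDual_apply hc a hv]
      exact Submodule.sum_mem _ fun i _ =>
        Submodule.smul_mem _ _ (Submodule.subset_span ⟨i, rfl⟩))

theorem IsFanOver.galeBasis_apply
    (h : IsFanOver 𝓕 (joinComplex fun i => simplexBoundary (n i)) x) (hc : IsCompleteFan 𝓕)
    (τ : ∀ i, Fin (n i + 1)) (i : Fin k) :
    h.galeBasis hc τ i = galeVector x ⟨i, τ i⟩ := by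
  simp [IsFanOver.galeBasis]

/-- The dictionary: a class is interior to the cone of `τ` iff `ψ` is strictly below `a` at the
omitted vertices. -/
theorem IsFanOver.galeBasis_coord
    (h : IsFanOver 𝓕 (joinComplex fun i => simplexBoundary (n i)) x) (hc : IsCompleteFan 𝓕)
    (τ : ∀ i, Fin (n i + 1)) (a : (Σ i : Fin k, Fin (n i + 1)) → ℝ) {ψ : Module.Dual ℝ V}
    (hψ : ∀ v ∈ transversalFacet τ, ψ (x v) = a v) (i : Fin k) :
    (h.galeBasis hc τ).coord i ((LinearMap.range (dualEval x)).mkQ a) =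
      a ⟨i, τ i⟩ - ψ (x ⟨i, τ i⟩) := by
  rw [mkQ_eq_sum_galeVector τ a hψ]
  simp only [← h.galeBasis_apply hc, Module.Basis.coord_apply, Module.Basis.repr_sum_self]

theorem IsFanOver.galeBasis_coord_pos
    (h : IsFanOver 𝓕 (joinComplex fun i => simplexBoundary (n i)) x) (hc : IsCompleteFan 𝓕)
    (τ : ∀ i, Fin (n i + 1)) (i : Fin k) (m : Fin (n i + 1)) :
    0 < (h.galeBasis hc τ).coord i (galeVector x ⟨i, m⟩) := by
  by_cases hm : m = τ i
  · rw [hm, ← h.galeBasis_apply hc, Module.Basis.coord_apply, Module.Basis.repr_self]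
    simp
  · rw [galeVector, h.galeBasis_coord hc τ _ fun v hv => h.facetDual_apply hc _ hv]
    have := h.facetDual_neg hc hm
    rw [Pi.single_eq_of_ne (by simpa using Ne.symm hm)]
    linarith

/-- A fan over a join of boundaries of simplices has a strictly convex support function as soon as
this holds for its projections to subsets of at most `k - 1` vertices of each factor. -/
theorem IsFanOver.exists_strictly_convex_of_small
    (h : IsFanOver 𝓕 (joinComplex fun i => simplexBoundary (n i)) x) (hc : IsCompleteFan 𝓕)
    (hk : 2 ≤ k)
    (hsmall : ∀ A : ∀ i : Fin k, Finset (Fin (n i + 1)),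
      (∀ i, (A i).Nonempty) → (∀ i, (A i).card ≤ k - 1) →
        ∃ a : (Σ i : Fin k, Fin (n i + 1)) → ℝ, ∀ τ : ∀ i, Fin (n i + 1), (∀ i, τ i ∈ A i) →
          ∃ ψ : Module.Dual ℝ V, (∀ v ∈ transversalFacet τ, ψ (x v) = a v) ∧
            ∀ i, ψ (x ⟨i, τ i⟩) < a ⟨i, τ i⟩) :
    ∃ a : (Σ i : Fin k, Fin (n i + 1)) → ℝ, ∀ τ : ∀ i, Fin (n i + 1),
      ∃ ψ : Module.Dual ℝ V, (∀ v ∈ transversalFacet τ, ψ (x v) = a v) ∧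
        ∀ i, ψ (x ⟨i, τ i⟩) < a ⟨i, τ i⟩ := by
  obtain ⟨z, hz⟩ := conesMeet_of_small (y := fun i m => galeVector x ⟨i, m⟩)
    (b := fun τ => h.galeBasis hc τ) (fun τ i => h.galeBasis_apply hc τ i)
    (fun τ i m => h.galeBasis_coord_pos hc τ i m) (by simpa using hk)
    (fun A hA hA' => by
      rw [Fintype.card_fin] at hA'
      obtain ⟨a, ha⟩ := hsmall A hA hA'
      refine ⟨(LinearMap.range (dualEval x)).mkQ a, fun τ hτ i => ?_⟩
      obtain ⟨ψ, hψ, hlt⟩ := ha τ hτ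
      rw [h.galeBasis_coord hc τ a hψ]
      exact sub_pos.2 (hlt i))
    (fun _ => Finset.univ) (fun _ => Finset.univ_nonempty)
  obtain ⟨a, rfl⟩ := Submodule.mkQ_surjective _ z
  refine ⟨a, fun τ => ⟨h.facetDual hc τ a, fun v hv => h.facetDual_apply hc a hv, fun i => ?_⟩⟩
  have := hz τ (fun _ => Finset.mem_univ _) i
  rw [h.galeBasis_coord hc τ a fun v hv => h.facetDual_apply hc a hv] at this
  exact sub_pos.1 this

/-- The case of a single factor. -/
theorem IsFanOver.exists_strictly_convex_of_subsingleton
    (h : IsFanOver 𝓕 (joinComplex fun i => simplexBoundary (n i)) x) (hc : IsCompleteFan 𝓕)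
    (hk : k = 1) :
    ∃ a : (Σ i : Fin k, Fin (n i + 1)) → ℝ, ∀ τ : ∀ i, Fin (n i + 1),
      ∃ ψ : Module.Dual ℝ V, (∀ v ∈ transversalFacet τ, ψ (x v) = a v) ∧
        ∀ i, ψ (x ⟨i, τ i⟩) < a ⟨i, τ i⟩ := by
  subst hk
  -- The Gale space is a line on which all Gale vectors point the same way, so any one of them
  -- serves.
  refine ⟨Pi.single ⟨0, 0⟩ 1, fun τ =>
    ⟨h.facetDual hc τ _, fun v hv => h.facetDual_apply hc _ hv, fun i => ?_⟩⟩
  have := h.galeBasis_coord_pos hc τ 0 0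
  rw [galeVector, h.galeBasis_coord hc τ _ fun v hv => h.facetDual_apply hc _ hv] at this
  rw [Subsingleton.elim i 0]
  exact sub_pos.1 this

end GaleDual

/-! ### Cones and convex hulls of finitely many points. -/

section FiniteHulls

variable {V : Type*} [AddCommGroup V] [Module ℝ V] {ν : Type*}

theorem exists_eq_sum_of_mem_hull {x : ν → V} {s : Finset ν} {q : V}
    (hq : q ∈ PointedCone.hull ℝ (x '' (s : Set ν))) :
    ∃ c : ν → ℝ, (∀ v ∈ s, 0 ≤ c v) ∧ q = ∑ v ∈ s, c v • x v := by
  classical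
  induction hq using Submodule.span_induction with
  | mem y hy =>
    obtain ⟨v, hv, rfl⟩ := hy
    refine ⟨Pi.single v 1, fun w _ => ?_, ?_⟩
    · by_cases hw : w = v
      · subst hw; simp
      · simp [hw]
    · rw [Finset.sum_eq_single_of_mem v hv]
      · simp
      · intro w _ hw; simp [hw]
  | zero => exact ⟨0, fun _ _ => le_rfl, by simp⟩
  | add y z _ _ hy hz =>
    obtain ⟨c, hc, rfl⟩ := hy
    obtain ⟨d, hd, rfl⟩ := hz
    exact ⟨c + d, fun v hv => add_nonneg (hc v hv) (hd v hv), by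
      simp [add_smul, Finset.sum_add_distrib]⟩
  | smul r y _ hy =>
    obtain ⟨c, hc, rfl⟩ := hy
    refine ⟨fun v => r * c v, fun v hv => mul_nonneg r.2 (hc v hv), ?_⟩
    rw [Finset.smul_sum]
    refine Finset.sum_congr rfl fun v _ => ?_
    rw [mul_smul]; rfl

theorem mem_convexHull_image_iff {x : ν → V} {s : Finset ν} {y : V} :
    y ∈ convexHull ℝ (x '' (s : Set ν)) ↔
      ∃ w : ν → ℝ, (∀ v ∈ s, 0 ≤ w v) ∧ ∑ v ∈ s, w v = 1 ∧ ∑ v ∈ s, w v • x v = y := by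
  classical
  constructor
  · intro hy
    refine convexHull_min (t := {y | ∃ w : ν → ℝ, (∀ v ∈ s, 0 ≤ w v) ∧ ∑ v ∈ s, w v = 1 ∧
      ∑ v ∈ s, w v • x v = y}) ?_ ?_ hy
    · rintro _ ⟨v, hv, rfl⟩
      refine ⟨Pi.single v 1, fun w _ => ?_, ?_, ?_⟩
      · by_cases hw : w = v
        · subst hw; simp
        · simp [hw]
      · rw [Finset.sum_pi_single']; simpa using hv
      · rw [Finset.sum_eq_single_of_mem v hv]
        · simp
        · intro w _ hw; simp [hw]
    · rintro _ ⟨w, hw, hw1, rfl⟩ _ ⟨w', hw', hw1', rfl⟩ p q hp hq hpq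
      refine ⟨fun v => p * w v + q * w' v, fun v hv =>
        add_nonneg (mul_nonneg hp (hw v hv)) (mul_nonneg hq (hw' v hv)), ?_, ?_⟩
      · rw [Finset.sum_add_distrib, ← Finset.mul_sum, ← Finset.mul_sum, hw1, hw1']
        linarith
      · simp only [add_smul, Finset.sum_add_distrib, Finset.smul_sum, smul_smul]
  · rintro ⟨w, hw, hw1, rfl⟩
    exact (convex_convexHull ℝ _).sum_mem hw hw1 fun v hv =>
      subset_convexHull ℝ _ ⟨v, hv, rfl⟩

theorem hull_convexHull (S : Set V) :
    PointedCone.hull ℝ (convexHull ℝ S) = PointedCone.hull ℝ S := by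
  refine le_antisymm (Submodule.span_le.2 (convexHull_min Submodule.subset_span ?_))
    (Submodule.span_mono (subset_convexHull ℝ S))
  exact (PointedCone.hull ℝ S).convex

/-- The set of maximisers of a linear functional on the convex hull of finitely many points. -/
theorem maximisers_convexHull_range [Fintype ν] {x : ν → V} {s : Finset ν} (hs : s.Nonempty)
    (l : Module.Dual ℝ V) {M : ℝ} (hle : ∀ v, l (x v) ≤ M) (heq : ∀ v, v ∈ s ↔ l (x v) = M) :
    {y ∈ convexHull ℝ (Set.range x) | ∀ y' ∈ convexHull ℝ (Set.range x), l y' ≤ l y} =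
      convexHull ℝ (x '' (s : Set ν)) := by
  classical
  have hr : Set.range x = x '' ((Finset.univ : Finset ν) : Set ν) := by simp
  have hM : ∀ y ∈ convexHull ℝ (Set.range x), l y ≤ M := fun y hy =>
    convexHull_min (t := {y | l y ≤ M}) (by rintro _ ⟨v, rfl⟩; exact hle v)
      (convex_halfSpace_le l.isLinear M) hy
  have hF : ∀ y ∈ convexHull ℝ (x '' (s : Set ν)), l y = M := fun y hy =>
    convexHull_min (t := {y | l y = M}) (by rintro _ ⟨v, hv, rfl⟩; exact (heq v).1 hv)
      (convex_hyperplane l.isLinear M) hy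
  obtain ⟨v₀, hv₀⟩ := hs
  ext y
  constructor
  · rintro ⟨hy, hmax⟩
    have hyM : l y = M := le_antisymm (hM y hy)
      ((heq v₀).1 hv₀ ▸ hmax _ (subset_convexHull ℝ _ ⟨v₀, rfl⟩))
    rw [hr, mem_convexHull_image_iff] at hy
    obtain ⟨w, hw, hw1, rfl⟩ := hy
    have hzero : ∑ v, w v * (M - l (x v)) = 0 := by
      simp only [mul_sub, Finset.sum_sub_distrib, ← Finset.sum_mul, hw1]
      simp only [map_sum, map_smul, smul_eq_mul] at hyM
      rw [hyM]; ring
    rw [Finset.sum_eq_zero_iff_of_nonneg fun v hv =>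
      mul_nonneg (hw v hv) (sub_nonneg.2 (hle v))] at hzero
    have hw0 : ∀ v, v ∉ s → w v = 0 := fun v hv =>
      (mul_eq_zero.1 (hzero v (Finset.mem_univ _))).resolve_right fun h =>
        hv ((heq v).2 (sub_eq_zero.1 h).symm)
    rw [mem_convexHull_image_iff]
    refine ⟨w, fun v _ => hw v (Finset.mem_univ _), ?_, ?_⟩
    · rw [← hw1]
      exact Finset.sum_subset (Finset.subset_univ _) fun v _ hv => hw0 v hv
    · exact Finset.sum_subset (Finset.subset_univ _) fun v _ hv => by rw [hw0 v hv, zero_smul]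
  · intro hy
    have hy' := convexHull_mono (Set.image_subset_range x _) hy
    exact ⟨hy', fun y' h' => (hM y' h').trans (hF y hy).ge⟩

end FiniteHulls

/-! ### From a strictly convex support function to a polytope. -/

section Polytopality

variable {V : Type*} [NormedAddCommGroup V] [NormedSpace ℝ V]
  {k : ℕ} {n : Fin k → ℕ} {𝓕 : Set (PointedCone ℝ V)} {x : (Σ i : Fin k, Fin (n i + 1)) → V}

/-- Some cone contains `-x v₀`, which gives a nontrivial nonnegative relation. -/
theorem IsFanOver.zero_mem_convexHull (hk : 0 < k)
    (h : IsFanOver 𝓕 (joinComplex fun i => simplexBoundary (n i)) x) (hc : IsCompleteFan 𝓕) :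
    (0 : V) ∈ convexHull ℝ (Set.range x) := by
  classical
  let v₀ : Σ i : Fin k, Fin (n i + 1) := ⟨⟨0, hk⟩, 0⟩
  obtain ⟨τ, hτ⟩ := h.exists_mem_facet hc (-x v₀)
  obtain ⟨c, hc0, hcx⟩ := exists_eq_sum_of_mem_hull hτ
  have hconv := convex_convexHull ℝ (Set.range x)
  have hx : ∀ v, x v ∈ convexHull ℝ (Set.range x) := fun v => subset_convexHull ℝ _ ⟨v, rfl⟩
  have hs := Finset.sum_nonneg hc0
  rcases hs.eq_or_lt with h0 | hpos
  · rw [eq_comm, Finset.sum_eq_zero_iff_of_nonneg hc0] at h0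
    rw [Finset.sum_eq_zero fun v hv => by rw [h0 v hv, zero_smul], neg_eq_zero] at hcx
    exact hcx ▸ hx v₀
  · set S := ∑ v ∈ transversalFacet τ, c v with hS
    have hm : S⁻¹ • (-x v₀) ∈ convexHull ℝ (Set.range x) := by
      have := Finset.centerMass_mem_convexHull (R := ℝ) (transversalFacet τ) (w := c) (z := x)
        (s := Set.range x) hc0 hpos (fun v _ => ⟨v, rfl⟩)
      rwa [Finset.centerMass, ← hcx] at this
    have h1S : 0 < 1 + S := by linarith
    have := hconv (hx v₀) hm (a := 1 / (1 + S)) (b := S / (1 + S)) (by positivity) (by positivity)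
      (by field_simp)
    convert this using 1
    rw [smul_smul, smul_neg, div_mul_eq_mul_div, mul_inv_cancel₀ hpos.ne', add_neg_cancel]

/-- A complete fan is strongly polytopal if it has a strictly convex support function, normalised
to be `1` at the generators. -/
theorem IsFanOver.isStronglyPolytopal_of_normalised [FiniteDimensional ℝ V] (hk : 0 < k)
    (h : IsFanOver 𝓕 (joinComplex fun i => simplexBoundary (n i)) x) (hc : IsCompleteFan 𝓕)
    (ψ : (∀ i, Fin (n i + 1)) → Module.Dual ℝ V)
    (hψ : ∀ τ, ∀ v ∈ transversalFacet τ, ψ τ (x v) = 1)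
    (hlt : ∀ τ, ∀ v ∉ transversalFacet τ, ψ τ (x v) < 1) : IsStronglyPolytopal 𝓕 := by
  classical
  have hle : ∀ τ v, ψ τ (x v) ≤ 1 := fun τ v => by
    by_cases hv : v ∈ transversalFacet τ
    · exact (hψ τ v hv).le
    · exact (hlt τ v hv).le
  have h0 := h.zero_mem_convexHull hk hc
  have hconv := convex_convexHull ℝ (Set.range x)
  have hface : ∀ s ∈ joinComplex (fun i => simplexBoundary (n i)),
      IsProperFace (convexHull ℝ (x '' (s : Set (Σ i, Fin (n i + 1))))) (convexHull ℝ (Set.range x)) := by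
    intro s hs
    rcases s.eq_empty_or_nonempty with rfl | hsne
    · refine ⟨fun hF => by simp at hF, fun hF => ?_⟩
      have := hF ▸ h0
      simp at this
    obtain ⟨τ₀, hτ₀⟩ := mem_joinComplex_simplexBoundary_iff.1 hs
    set R := Finset.univ.filter fun τ : ∀ i, Fin (n i + 1) => s ⊆ transversalFacet τ with hR
    set l : Module.Dual ℝ V := ∑ τ ∈ R, ψ τ with hl
    have hlx : ∀ v, l (x v) = ∑ τ ∈ R, ψ τ (x v) := fun v => by simp [hl]
    have hcard : (R.card : ℝ) = ∑ τ ∈ R, (1 : ℝ) := by simp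
    have hmax := maximisers_convexHull_range hsne l (M := R.card)
      (fun v => by rw [hlx, hcard]; exact Finset.sum_le_sum fun τ _ => hle τ v)
      (fun v => by
        rw [hlx, hcard]
        constructor
        · intro hv
          exact Finset.sum_congr rfl fun τ hτ => hψ τ v ((Finset.mem_filter.1 hτ).2 hv)
        · intro hv
          by_contra hvs
          refine hv.not_lt (Finset.sum_lt_sum (fun τ _ => hle τ v)
            ⟨Function.update τ₀ v.1 v.2, ?_, hlt _ v (by simp)⟩)
          rw [hR, Finset.mem_filter]
          refine ⟨Finset.mem_univ _, ?_⟩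
          rintro ⟨j, m⟩ hw
          rw [mem_transversalFacet]
          by_cases hj : j = v.1
          · obtain ⟨i, m'⟩ := v
            dsimp only at hj
            subst hj
            simp only [Function.update_self, ne_eq]
            rintro rfl
            exact hvs hw
          · simpa [hj] using hτ₀ hw)
    have hRpos : (0 : ℝ) < R.card := by
      exact_mod_cast Finset.card_pos.2 ⟨τ₀, Finset.mem_filter.2 ⟨Finset.mem_univ _, hτ₀⟩⟩
    refine ⟨fun _ => ⟨l.toContinuousLinearMap, hmax.symm⟩, fun hF => ?_⟩
    rw [← hF, ← hmax] at h0
    obtain ⟨v, hv⟩ := hsne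
    have h1 := h0.2 (x v) (subset_convexHull ℝ _ ⟨v, rfl⟩)
    have h2 : ∑ τ ∈ R, ψ τ (x v) = ∑ τ ∈ R, (1 : ℝ) :=
      Finset.sum_congr rfl fun τ hτ => hψ τ v ((Finset.mem_filter.1 hτ).2 hv)
    rw [map_zero, hlx, h2, ← hcard] at h1
    linarith
  have hface' : ∀ F, IsProperFace F (convexHull ℝ (Set.range x)) →
      ∃ s ∈ joinComplex (fun i => simplexBoundary (n i)),
        F = convexHull ℝ (x '' (s : Set (Σ i, Fin (n i + 1)))) := by
    rintro F ⟨hexp, hFne⟩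
    rcases F.eq_empty_or_nonempty with rfl | hFn
    · exact ⟨∅, mem_joinComplex_simplexBoundary_iff.2 ⟨fun _ => 0, by simp⟩, by simp⟩
    obtain ⟨l, hl⟩ := hexp hFn
    obtain ⟨y₀, hy₀⟩ := hFn
    have hy₀' := hy₀
    rw [hl] at hy₀'
    set M := l y₀ with hM
    have hlM : ∀ v, l (x v) ≤ M := fun v => hy₀'.2 _ (subset_convexHull ℝ _ ⟨v, rfl⟩)
    set s := Finset.univ.filter fun v => l (x v) = M with hs
    have hsne : s.Nonempty := by
      by_contra hemp
      rw [Finset.not_nonempty_iff_eq_empty] at hemp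
      have hlt' : ∀ v, l (x v) < M := fun v => (hlM v).lt_of_ne fun he => by
        have : v ∈ s := Finset.mem_filter.2 ⟨Finset.mem_univ _, he⟩
        simp [hemp] at this
      have : l y₀ < M := convexHull_min (t := {y | l y < M}) (by rintro _ ⟨v, rfl⟩; exact hlt' v)
        (convex_halfSpace_lt l.isLinear M) hy₀'.1
      exact this.ne rfl
    have hFs : F = convexHull ℝ (x '' (s : Set (Σ i, Fin (n i + 1)))) := by
      rw [hl]
      exact maximisers_convexHull_range hsne (l : Module.Dual ℝ V) hlM fun v => by simp [hs]
    have hMpos : 0 < M := by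
      have hM0 : 0 ≤ M := by simpa using hy₀'.2 0 h0
      refine hM0.lt_of_ne fun hM0 => hFne ?_
      rw [hFs]
      have : s = Finset.univ := by
        rw [hs, Finset.filter_eq_self]
        intro v _
        refine le_antisymm (hlM v) ?_
        obtain ⟨τ, hτ⟩ := h.exists_mem_facet hc (-x v)
        obtain ⟨c, hc0, hcx⟩ := exists_eq_sum_of_mem_hull hτ
        have h1 : l (-x v) ≤ 0 := by
          rw [hcx, map_sum]
          refine Finset.sum_nonpos fun w hw => ?_
          rw [map_smul, smul_eq_mul]
          exact mul_nonpos_of_nonneg_of_nonpos (hc0 w hw) (hM0 ▸ hlM w)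
        rw [map_neg] at h1
        linarith
      rw [this]; simp
    refine ⟨s, mem_joinComplex_simplexBoundary_iff.2 ?_, hFs⟩
    -- Evaluating this vector by `l` and by `ψ τ` gives `|s| ≤ ∑ c = ∑ ψ τ (x v) ≤ |s|`, so `ψ τ`
    -- equals `1` on `s`.
    obtain ⟨τ, hτ⟩ := h.exists_mem_facet hc (∑ v ∈ s, x v)
    obtain ⟨c, hc0, hcx⟩ := exists_eq_sum_of_mem_hull hτ
    refine ⟨τ, fun v hv => ?_⟩
    have e1 : ∑ v ∈ s, ψ τ (x v) = ∑ v ∈ transversalFacet τ, c v := by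
      rw [← map_sum, hcx, map_sum]
      exact Finset.sum_congr rfl fun w hw => by rw [map_smul, hψ τ w hw, smul_eq_mul, mul_one]
    have e2 : M * s.card ≤ M * ∑ v ∈ transversalFacet τ, c v := by
      have : l (∑ v ∈ s, x v) = M * s.card := by
        have h1 : ∑ v ∈ s, l (x v) = ∑ v ∈ s, M :=
          Finset.sum_congr rfl fun v hv => (Finset.mem_filter.1 hv).2
        rw [map_sum, h1, Finset.sum_const, nsmul_eq_mul, mul_comm]
      rw [← this, hcx, map_sum, Finset.mul_sum]
      refine Finset.sum_le_sum fun w hw => ?_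
      rw [map_smul, smul_eq_mul, mul_comm]
      exact mul_le_mul_of_nonneg_right (hlM w) (hc0 w hw)
    have e3 := le_of_mul_le_mul_left e2 hMpos
    by_contra hvn
    have e4 : ∑ v ∈ s, ψ τ (x v) < ∑ v ∈ s, (1 : ℝ) :=
      Finset.sum_lt_sum (fun w _ => hle τ w) ⟨v, hv, hlt τ v hvn⟩
    rw [e1] at e4
    simp only [Finset.sum_const, nsmul_eq_mul, mul_one] at e4
    linarith
  refine ⟨convexHull ℝ (Set.range x), ⟨⟨_, Set.finite_range x, rfl⟩, fun F hF => ?_⟩, ?_, ?_⟩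
  · obtain ⟨s, hs, rfl⟩ := hface' F hF
    refine ⟨s.image x, ?_, by simp⟩
    have := (h.linearIndepOn s hs).id_image
    have h2 : LinearIndependent ℝ ((↑) : {y // y ∈ s.image x} → V) := by
      rw [← Finset.coe_image] at this
      exact this
    exact h2.affineIndependent
  · rw [mem_interior]
    -- A point of the cone of `τ` with `ψ τ < 1` has coefficient sum below `1`, so it lies in the
    -- hull together with `0`.
    refine ⟨⋂ τ, {q | ψ τ q < 1}, fun q hq => ?_, ?_, ?_⟩
    · rw [Set.mem_iInter] at hq
      obtain ⟨τ, hτ⟩ := h.exists_mem_facet hc q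
      obtain ⟨c, hc0, rfl⟩ := exists_eq_sum_of_mem_hull hτ
      have hq' := hq τ
      have hsum : ψ τ (∑ v ∈ transversalFacet τ, c v • x v) = ∑ v ∈ transversalFacet τ, c v := by
        rw [map_sum]
        exact Finset.sum_congr rfl fun w hw => by rw [map_smul, hψ τ w hw, smul_eq_mul, mul_one]
      rw [Set.mem_ofPred_eq, hsum] at hq'
      rcases (Finset.sum_nonneg hc0).eq_or_lt with hz | hpos
      · rw [eq_comm, Finset.sum_eq_zero_iff_of_nonneg hc0] at hz
        rw [Finset.sum_eq_zero fun v hv => by rw [hz v hv, zero_smul]]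
        exact h0
      · have hm := Finset.centerMass_mem_convexHull (R := ℝ) (transversalFacet τ) (w := c) (z := x)
          (s := Set.range x) hc0 hpos (fun v _ => ⟨v, rfl⟩)
        have := hconv.smul_mem_of_zero_mem h0 hm ⟨hpos.le, hq'.le⟩
        rwa [Finset.centerMass, smul_smul, mul_inv_cancel₀ hpos.ne', one_smul] at this
    · exact isOpen_iInter_of_finite fun τ =>
        isOpen_lt (ψ τ).continuous_of_finiteDimensional continuous_const
    · simp
  · rw [h.cones_eq]
    ext C
    constructor
    · rintro ⟨s, hs, rfl⟩
      exact ⟨_, hface s hs, hull_convexHull _⟩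
    · rintro ⟨F, hF, rfl⟩
      obtain ⟨s, hs, rfl⟩ := hface' F hF
      exact ⟨s, hs, (hull_convexHull _).symm⟩

/-- Rescaling the generators of a simplicial fan. -/
theorem IsFanOver.smul_generators {ν : Type*} {K : Set (Finset ν)} {x : ν → V}
    (h : IsFanOver 𝓕 K x) (c : ν → ℝ) (hc : ∀ v, 0 < c v) :
    IsFanOver 𝓕 K fun v => c v • x v := by
  have key : ∀ s : Finset ν, PointedCone.hull ℝ ((fun v => c v • x v) '' (s : Set ν)) =
      PointedCone.hull ℝ (x '' (s : Set ν)) := by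
    intro s
    refine le_antisymm (Submodule.span_le.2 ?_) (Submodule.span_le.2 ?_)
    · rintro _ ⟨v, hv, rfl⟩
      exact Submodule.smul_mem _ (⟨c v, (hc v).le⟩ : NNReal) (Submodule.subset_span ⟨v, hv, rfl⟩)
    · rintro _ ⟨v, hv, rfl⟩
      have := Submodule.smul_mem (PointedCone.hull ℝ ((fun v => c v • x v) '' (s : Set ν)))
        (⟨(c v)⁻¹, (inv_pos.2 (hc v)).le⟩ : NNReal) (Submodule.subset_span ⟨v, hv, rfl⟩)
      have e : (⟨(c v)⁻¹, (inv_pos.2 (hc v)).le⟩ : NNReal) • (c v • x v) = x v := by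
        change (c v)⁻¹ • (c v • x v) = x v
        rw [smul_smul, inv_mul_cancel₀ (hc v).ne', one_smul]
      rwa [e] at this
  refine ⟨h.isFan, fun s hs => ?_, ?_, ?_⟩
  · exact (h.linearIndepOn s hs).units_smul fun v => Units.mk0 (c v) (hc v).ne'
  · simp only [key]; exact h.cones_eq
  · simp only [key]; exact h.injOn

/-- A complete fan with a strictly convex support function is strongly polytopal. -/
theorem IsFanOver.isStronglyPolytopal_of_strictly_convex [FiniteDimensional ℝ V] (hk : 0 < k)
    (h : IsFanOver 𝓕 (joinComplex fun i => simplexBoundary (n i)) x) (hc : IsCompleteFan 𝓕)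
    (a : (Σ i : Fin k, Fin (n i + 1)) → ℝ)
    (ha : ∀ τ : ∀ i, Fin (n i + 1), ∃ ψ : Module.Dual ℝ V,
      (∀ v ∈ transversalFacet τ, ψ (x v) = a v) ∧ ∀ i, ψ (x ⟨i, τ i⟩) < a ⟨i, τ i⟩) :
    IsStronglyPolytopal 𝓕 := by
  classical
  choose ψ hψ hlt using ha
  have hlt' : ∀ τ, ∀ v ∉ transversalFacet τ, ψ τ (x v) < a v := by
    rintro τ ⟨i, m⟩ hv
    have : m = τ i := by simpa using hv
    rw [this]; exact hlt τ i
  have hle : ∀ τ v, ψ τ (x v) ≤ a v := fun τ v => by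
    by_cases hv : v ∈ transversalFacet τ
    · exact (hψ τ v hv).le
    · exact (hlt' τ v hv).le
  set N : ℝ := (Fintype.card (∀ i, Fin (n i + 1)) : ℝ) with hN
  have hNpos : 0 < N := by rw [hN]; exact_mod_cast Fintype.card_pos
  -- Subtracting the sum of the `ψ τ` from `N * a` makes all values positive, since each vertex is
  -- omitted by some facet. Rescaling the generators then normalises them to `1`.
  set a' : (Σ i : Fin k, Fin (n i + 1)) → ℝ := fun v => ∑ τ, (a v - ψ τ (x v)) with ha'
  have ha'eq : ∀ v, a' v = N * a v - ∑ τ, ψ τ (x v) := fun v => by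
    simp [ha', hN, Finset.sum_sub_distrib]
  have ha'pos : ∀ v, 0 < a' v := fun v =>
    Finset.sum_pos' (fun τ _ => sub_nonneg.2 (hle τ v))
      ⟨Function.update (fun _ => 0) v.1 v.2, Finset.mem_univ _,
        sub_pos.2 (hlt' _ v (by simp))⟩
  refine (h.smul_generators (fun v => (a' v)⁻¹)
    fun v => inv_pos.2 (ha'pos v)).isStronglyPolytopal_of_normalised hk hc
    (fun τ => N • ψ τ - ∑ τ', ψ τ') (fun τ v hv => ?_) (fun τ v hv => ?_)
  · rw [map_smul, smul_eq_mul, inv_mul_eq_one₀ (ha'pos v).ne', ha'eq]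
    simp [LinearMap.sum_apply, hψ τ v hv]
  · rw [map_smul, smul_eq_mul, inv_mul_lt_one₀ (ha'pos v), ha'eq]
    simp only [LinearMap.sub_apply, LinearMap.smul_apply, LinearMap.sum_apply, smul_eq_mul]
    have := mul_lt_mul_of_pos_left (hlt' τ v hv) hNpos
    linarith

end Polytopality

/-! ### Support functions from polytopal projected fans. -/

section SupportFunctions

/-- For a proper face `F` of a polytope `P` with the origin in its interior there is a linear
functional that agrees with the gauge of `P` on the cone over `F` and is smaller elsewhere. -/
theorem IsProperFace.exists_dual_gauge {W : Type*} [AddCommGroup W] [Module ℝ W]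
    [TopologicalSpace W] [IsTopologicalAddGroup W] [ContinuousSMul ℝ W] [T2Space W] {F P : Set W}
    (hP : ∃ X : Set W, X.Finite ∧ P = convexHull ℝ X) (h0 : 0 ∈ interior P)
    (hF : IsProperFace F P) :
    ∃ l : Module.Dual ℝ W, (∀ w ∈ PointedCone.hull ℝ F, l w = gauge P w) ∧
      ∀ w ∉ PointedCone.hull ℝ F, l w < gauge P w := by
  obtain ⟨X, hX, hPX⟩ := hP
  have hconv : Convex ℝ P := hPX ▸ convex_convexHull ℝ X
  have hcomp : IsCompact P := hPX ▸ hX.isCompact_convexHull ℝ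
  have hnhds : P ∈ nhds (0 : W) := mem_interior_iff_mem_nhds.1 h0
  have habs : Absorbent ℝ P := absorbent_nhds_zero hnhds
  have hbdd : Bornology.IsVonNBounded ℝ P := hcomp.isVonNBounded ℝ
  rcases F.eq_empty_or_nonempty with rfl | hFn
  · refine ⟨0, fun w hw => ?_, fun w hw => ?_⟩
    · have : w = 0 := by simpa using hw
      rw [this, gauge_zero, map_zero]
    · exact (gauge_pos habs hbdd).2 fun h => hw (h ▸ Submodule.zero_mem _)
  obtain ⟨l, hl⟩ := hF.1 hFn
  obtain ⟨y₀, hy₀⟩ := hFn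
  have hy₀' := hy₀
  rw [hl] at hy₀'
  set M := l y₀ with hM
  have hlM : ∀ y ∈ P, l y ≤ M := hy₀'.2
  have hFM : ∀ y, y ∈ F ↔ y ∈ P ∧ l y = M := fun y => by
    rw [hl]
    exact ⟨fun h => ⟨h.1, le_antisymm (hlM y h.1) (h.2 _ hy₀'.1)⟩,
      fun h => ⟨h.1, fun y' hy' => (hlM y' hy').trans h.2.ge⟩⟩
  have hMpos : 0 < M := by
    have hM0 : 0 ≤ M := by simpa using hlM 0 (interior_subset h0)
    refine hM0.lt_of_ne fun hM0 => hF.2 ?_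
    have hle : ∀ w, l w ≤ 0 := fun w => by
      obtain ⟨b, hb, -, y, hy, rfl⟩ := exists_lt_of_gauge_lt habs (lt_add_one (gauge P w))
      change l (b • y) ≤ 0
      rw [map_smul, smul_eq_mul]
      exact mul_nonpos_of_nonneg_of_nonpos hb.le (hM0 ▸ hlM y hy)
    have hzero : ∀ w, l w = 0 := fun w =>
      le_antisymm (hle w) (by have := hle (-w); rw [map_neg] at this; linarith)
    ext y
    rw [hFM, hzero y, ← hM0]
    simp
  have hleg : ∀ w, M⁻¹ * l w ≤ gauge P w := fun w => by
    refine le_of_forall_gt fun c hc => ?_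
    obtain ⟨b, hb, hbc, y, hy, rfl⟩ := exists_lt_of_gauge_lt habs hc
    refine lt_of_le_of_lt ?_ hbc
    change M⁻¹ * l (b • y) ≤ b
    rw [map_smul, smul_eq_mul, inv_mul_le_iff₀ hMpos, mul_comm]
    exact mul_le_mul_of_nonneg_right (hlM y hy) hb.le
  refine ⟨M⁻¹ • (l : Module.Dual ℝ W), fun w hw => le_antisymm (hleg w) ?_, fun w hw => ?_⟩
  · induction hw using Submodule.span_induction with
    | mem y hy =>
      obtain ⟨hyP, hyM⟩ := (hFM y).1 hy
      change gauge P y ≤ M⁻¹ * l y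
      rw [hyM, inv_mul_cancel₀ hMpos.ne']
      exact gauge_le_one_of_mem hyP
    | zero => simp [gauge_zero]
    | add y z _ _ hy hz =>
      rw [map_add]
      exact (gauge_add_le hconv habs y z).trans (add_le_add hy hz)
    | smul r y _ hy =>
      change gauge P ((r : ℝ) • y) ≤ M⁻¹ * l ((r : ℝ) • y)
      rw [gauge_smul_of_nonneg r.2, map_smul, smul_eq_mul, smul_eq_mul, mul_left_comm]
      exact mul_le_mul_of_nonneg_left hy r.2
  · refine (hleg w).lt_of_ne fun heq => hw ?_
    change M⁻¹ * l w = gauge P w at heq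
    rcases (gauge_nonneg (s := P) w).eq_or_lt with hz | hpos
    · rw [eq_comm, gauge_eq_zero habs hbdd] at hz
      rw [hz]; exact Submodule.zero_mem _
    · set g := gauge P w with hg
      have hmem : g⁻¹ • w ∈ F := by
        rw [hFM]
        constructor
        · rw [← hcomp.isClosed.closure_eq, ← gauge_le_one_iff_mem_closure hconv hnhds,
            gauge_smul_of_nonneg (inv_nonneg.2 hpos.le), ← hg, smul_eq_mul,
            inv_mul_cancel₀ hpos.ne']
        · rw [map_smul, smul_eq_mul, ← heq]
          have hlw : l w ≠ 0 := fun h0 => by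
            rw [h0, mul_zero] at heq; exact hpos.ne heq
          field_simp
      have := Submodule.smul_mem (PointedCone.hull ℝ F) (⟨g, hpos.le⟩ : NNReal)
        (Submodule.subset_span hmem)
      have e : (⟨g, hpos.le⟩ : NNReal) • (g⁻¹ • w) = w := by
        change g • (g⁻¹ • w) = w
        rw [smul_smul, mul_inv_cancel₀ hpos.ne', one_smul]
      rwa [e] at this

variable {V : Type*} [NormedAddCommGroup V] [NormedSpace ℝ V] [FiniteDimensional ℝ V]
  {k : ℕ} {n : Fin k → ℕ} {𝓕 : Set (PointedCone ℝ V)} {x : (Σ i : Fin k, Fin (n i + 1)) → V}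

/-- A strongly polytopal projected fan provides a strictly convex support function on the
cones of the fan that contain the cone from which one projects. -/
theorem IsFanOver.exists_strictly_convex_of_projected
    (h : IsFanOver 𝓕 (joinComplex fun i => simplexBoundary (n i)) x) (hc : IsCompleteFan 𝓕)
    (A : ∀ i : Fin k, Finset (Fin (n i + 1)))
    (hpoly : IsStronglyPolytopal
      (projectedFan 𝓕 (PointedCone.hull ℝ (x '' {v | v.2 ∉ A v.1})))) :
    ∃ a : (Σ i : Fin k, Fin (n i + 1)) → ℝ, ∀ τ : ∀ i, Fin (n i + 1), (∀ i, τ i ∈ A i) →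
      ∃ ψ : Module.Dual ℝ V, (∀ v ∈ transversalFacet τ, ψ (x v) = a v) ∧
        ∀ i, ψ (x ⟨i, τ i⟩) < a ⟨i, τ i⟩ := by
  classical
  set σ := PointedCone.hull ℝ (x '' {v | v.2 ∉ A v.1}) with hσ
  set S := Submodule.span ℝ (σ : Set V) with hS
  have : IsClosed (S : Set V) := S.closed_of_finiteDimensional
  obtain ⟨P, ⟨hPX, -⟩, h0, hPF⟩ := hpoly
  -- If `A v.1 = {v.2}`, the rest of the factor lies in the projecting face, so `v` is in no cone
  -- containing `σ` and the gauge need not be strict there. As `v` is in none of the facets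
  -- considered, raising its value by `1` is harmless.
  refine ⟨fun v => gauge P (S.mkQ (x v)) + if A v.1 = {v.2} then 1 else 0, fun τ hτ => ?_⟩
  have hsub : ∀ v : Σ i : Fin k, Fin (n i + 1), v.2 ∉ A v.1 → v ∈ transversalFacet τ := by
    intro v hv
    rw [mem_transversalFacet]
    intro he
    exact hv (he ▸ hτ v.1)
  have hmem : PointedCone.map S.mkQ (PointedCone.hull ℝ (x '' (transversalFacet τ : Set _))) ∈
      projectedFan 𝓕 σ :=
    ⟨_, ⟨h.facet_mem τ, Submodule.span_mono (Set.image_mono fun v hv => hsub v hv)⟩, rfl⟩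
  rw [hPF] at hmem
  obtain ⟨F, hF, hFC⟩ := hmem
  obtain ⟨l, hleq, hllt⟩ := IsProperFace.exists_dual_gauge hPX h0 hF
  rw [hFC] at hleq hllt
  refine ⟨l ∘ₗ S.mkQ, fun v hv => ?_, fun i => ?_⟩
  · have hne : A v.1 ≠ {v.2} := fun he => by
      have := hτ v.1
      rw [he, Finset.mem_singleton] at this
      exact mem_transversalFacet.1 hv this.symm
    simp only [hne, if_false, add_zero]
    exact hleq _ (PointedCone.mem_map.2 ⟨x v, Submodule.subset_span ⟨v, hv, rfl⟩, rfl⟩)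
  · dsimp only
    by_cases hA : A i = {τ i}
    · rw [if_pos hA]
      refine lt_of_le_of_lt ?_ (lt_add_one _)
      by_cases hw : S.mkQ (x ⟨i, τ i⟩) ∈
          PointedCone.map S.mkQ (PointedCone.hull ℝ (x '' (transversalFacet τ : Set _)))
      · exact (hleq _ hw).le
      · exact (hllt _ hw).le
    · rw [if_neg hA, add_zero]
      refine hllt _ fun hw => ?_
      obtain ⟨m, hm, hmτ⟩ : ∃ m ∈ A i, m ≠ τ i := by
        by_contra hcon
        push Not at hcon
        exact hA (Finset.eq_singleton_iff_unique_mem.2 ⟨hτ i, hcon⟩)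
      obtain ⟨q, hq, hqw⟩ := PointedCone.mem_map.1 hw
      have hneg := h.facetDual_neg hc hmτ
      -- `(i, m)` is not a vertex of `σ`, so `φ` descends to the quotient, where it separates the
      -- image of `x ⟨i, τ i⟩` from the image cone.
      set φ := h.facetDual hc τ (Pi.single ⟨i, m⟩ 1) with hφ
      have hφS : ∀ s ∈ S, φ s = 0 := by
        have hle : S ≤ LinearMap.ker φ := by
          refine Submodule.span_le.2 fun s hs => ?_
          refine Submodule.span_induction ?_ ?_ ?_ ?_ hs
          · rintro _ ⟨v, hv, rfl⟩
            rw [SetLike.mem_coe, LinearMap.mem_ker, hφ, h.facetDual_apply hc _ (hsub v hv),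
              Pi.single_eq_of_ne]
            rintro rfl
            exact hv hm
          · exact Submodule.zero_mem _
          · intro y z _ _ hy hz
            exact Submodule.add_mem _ hy hz
          · intro r y _ hy
            exact Submodule.smul_mem _ (r : ℝ) hy
        exact fun s hs => hle hs
      have hφq : 0 ≤ φ q := by
        obtain ⟨c, hc0, rfl⟩ := exists_eq_sum_of_mem_hull hq
        rw [map_sum]
        refine Finset.sum_nonneg fun v hv => ?_
        rw [map_smul, smul_eq_mul, hφ, h.facetDual_apply hc _ hv]
        refine mul_nonneg (hc0 v hv) ?_
        by_cases hvm : v = ⟨i, m⟩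
        · subst hvm; simp
        · simp [hvm]
      have hsub' := hφS (q - x ⟨i, τ i⟩) ((Submodule.Quotient.eq S).1 hqw)
      rw [map_sub] at hsub'
      linarith

end SupportFunctions

/-! ### The zero-dimensional case and the theorem. -/

theorem isStronglyPolytopal_of_subsingleton {V : Type*} [NormedAddCommGroup V] [NormedSpace ℝ V]
    [Subsingleton V] {𝓕 : Set (PointedCone ℝ V)} (hne : 𝓕.Nonempty) : IsStronglyPolytopal 𝓕 := by
  have hcone : ∀ C : PointedCone ℝ V, C = ⊥ := fun C => Subsingleton.elim _ _
  have hface : ∀ F, IsProperFace F ({0} : Set V) ↔ F = ∅ := by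
    intro F
    constructor
    · rintro ⟨-, hF⟩
      by_contra h
      obtain ⟨y, hy⟩ := Set.nonempty_iff_ne_empty.2 h
      refine hF ?_
      ext z
      exact iff_of_true (Subsingleton.elim y z ▸ hy) (Subsingleton.elim z 0)
    · rintro rfl
      exact ⟨fun h => by simp at h, fun h => by simpa using h.symm⟩
  refine ⟨{0}, ⟨⟨{0}, Set.finite_singleton 0, by simp⟩, fun F hF => ?_⟩, ?_, ?_⟩
  · exact ⟨∅, affineIndependent_of_subsingleton ℝ _, by simpa using (hface F).1 hF⟩
  · have : ({0} : Set V) = Set.univ := Set.eq_univ_iff_forall.2 fun z => Subsingleton.elim z 0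
    rw [this, interior_univ]
    trivial
  · ext C
    simp only [hcone C]
    constructor
    · intro _
      exact ⟨∅, (hface ∅).2 rfl, hcone _⟩
    · intro _
      obtain ⟨D, hD⟩ := hne
      rwa [hcone D] at hD

theorem mainTheorem8 {V : Type*} [NormedAddCommGroup V] [NormedSpace ℝ V] [FiniteDimensional ℝ V]
    {k : ℕ} (n : Fin k → ℕ) (hn : ∀ i, 1 ≤ n i)
    (𝓕 : Set (PointedCone ℝ V)) (x : (Σ i : Fin k, Fin (n i + 1)) → V)
    (hover : IsFanOver 𝓕 (joinComplex fun i => simplexBoundary (n i)) x)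
    (hcomplete : IsCompleteFan 𝓕)
    (hproj : ∀ A : ∀ i : Fin k, Finset (Fin (n i + 1)),
      (∀ i, (A i).Nonempty) → (∀ i, (A i).card ≤ k - 1) →
        IsStronglyPolytopal
          (projectedFan 𝓕 (PointedCone.hull ℝ (x '' {v | v.2 ∉ A v.1})))) :
    IsStronglyPolytopal 𝓕 := by
  -- For `k = 1` no nonempty set has at most `k - 1 = 0` elements, so the hypothesis is vacuous and
  -- polytopality is shown directly; for `k = 0` the space is a point.
  rcases Nat.lt_or_ge k 2 with hk | hk
  · interval_cases k
    · have : Subsingleton V := by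
        refine ⟨fun v w => ?_⟩
        have h0 : ∀ v : V, v = 0 := fun v => by
          obtain ⟨τ, hτ⟩ := hover.exists_mem_facet hcomplete v
          obtain ⟨c, -, rfl⟩ := exists_eq_sum_of_mem_hull hτ
          exact Finset.sum_eq_zero fun u _ => u.1.elim0
        rw [h0 v, h0 w]
      obtain ⟨C, hC, -⟩ := hcomplete.2 0
      exact isStronglyPolytopal_of_subsingleton ⟨C, hC⟩
    · obtain ⟨a, ha⟩ := hover.exists_strictly_convex_of_subsingleton hcomplete rfl
      exact hover.isStronglyPolytopal_of_strictly_convex one_pos hcomplete a ha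
  · obtain ⟨a, ha⟩ := hover.exists_strictly_convex_of_small hcomplete hk fun A hA hA' =>
      hover.exists_strictly_convex_of_projected hcomplete A (hproj A hA hA')
    exact hover.isStronglyPolytopal_of_strictly_convex (by omega) hcomplete a ha
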